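/- Let $k$ be a field and let $1\le r\le d$ be integers. Put $R=k[x_1,\dots,x_{2d}]/(x_1x_{d+1},\,x_2x_{d+2},\dots,x_dx_{2d})$, graded by giving the variables arbitrary positive integer degrees, and consider the graded $R$-modules $M=R/(x_1,\dots,x_r)$ and $N=R/(x_{r+1},\dots,x_{2d})$. Notation. $\lambda$ denotes length. Put $\mathrm f_R(M,N)=\inf\{n\in\mathbb Z: \lambda(\operatorname{Ext}^i_R(M,N))<\infty\text{ for all }i>n\}$, and $\beta_i=\lambda(\operatorname{Ext}^i_R(M,N))$ for $i>\mathrm f_R(M,N)$. When $\mathrm f_R(M,N)<\infty$, the complexity is $$\operatorname{cx}_R(M,N)=\inf\{b\in\mathbb N:\ \text{there is } a\in\mathbb R\text{ with }\beta_n\le a\,n^{b-1}\text{ for all } n\gg0\}.$$ The even and odd Hilbert polynomials are the polynomials $P_{\rm even},P_{\rm odd}\in\mathbb Q[t]$ with $P_{\rm even}(2i)=\beta_{2i}$ and $P_{\rm odd}(2i+1)=\beta_{2i+1}$ for all $i\gg 0$. With $s=\operatorname{cx}_R(M,N)$, $h_R(M,N)$ is the coefficient of $t^{s-1}$ in $P_{\rm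 even}$ minus the coefficient of $t^{s-1}$ in $P_{\rm odd}$ if $s>0$, and $h_R(M,N)=0$ if $s=0$. The ring $R$ is regular in codimension $u$ if $R_{\mathfrak p}$ is a regular local ring for every homogeneous prime ideal $\mathfrak p$ of $R$ with $\dim R-\dim R/\mathfrak p\le u$. An $R$-module $L$ has a rank if $L\otimes_R K$ is a free $K$-module of some finite rank, where $K$ is the total ring of fractions of $R$. Then $R$ is a graded complete intersection of codimension $d$ (the ideal $(x_1x_{d+1},\dots,x_dx_{2d})$ lies in $(x_1,\dots,x_{2d})^2$ and is generated by a homogeneous regular sequence of length $d$), $M$ and $N$ are quotients of $R$ by homogeneous ideals, $\mathrm f_R(M,N)<\infty$, the polynomials $P_{\rm even}$ and $P_{\rm odd}$ exist, and: 1. $\dim M=d=\dim R$ and $\dim N=r$. 2. $\operatorname{cx}_R(M,N)=r$ (so $\operatorname{cx}_R(M,N)=\min\{\dim M,\dim N\}\geq 1$). 3. $h_R(M,N)\ne0$. 4. $R$ is regular in codimension $0$, but it does not have a unique minimal prime ideal, and it is not regular in codimension $1$. 5. If $r<d$, then $R$ is not regular in codimension $d-r=\dim R-\operatorname{cx}_R(M,N)$.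 If $r=d$, then neither $M$ nor $N$ has a rank. Consequently, in the theorem that $h_R(M,N)=0$ for finitely generated graded modules $M,N$ over a graded complete intersection $R$ with $\mathrm f_R(M,N)<\infty$ and $\operatorname{cx}_R(M,N)=\min\{\dim M,\dim N\}\ge1$, provided that $R$ is regular in codimension $\dim R-\operatorname{cx}_R(M,N)$ and that, if $\dim R=\operatorname{cx}_R(M,N)$, $M$ or $N$ has a rank, these two additional conditions (on regularity and on rank) cannot be omitted. -/

import Mathlib

universe u

noncomputable section

namespace ExtAsymptotics

open MvPolynomial CategoryTheory

section Pairs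

variable (R : Type u) [CommRing R] (M N : Type u) [AddCommGroup M] [Module R M]
  [AddCommGroup N] [Module R N]

/-- The length of the `R`-module `Ext^i_R(M, N)`, possibly infinite. -/
def extLength (i : ℕ) : ℕ∞ :=
  Module.length R (Abelian.Ext (ModuleCat.of R M) (ModuleCat.of R N) i)

/-- `f_R(M, N)`: the infimum, in the extended reals, of the integers `n` such that
`Ext^i_R(M, N)` has finite length for all `i > n`. (`Ext^i = 0` for `i < 0`.) -/
def fext : EReal :=
  sInf ((fun n : ℤ => ((n : ℝ) : EReal)) ''
    {n : ℤ | ∀ i : ℕ, n < (i : ℤ) → extLength R M N i ≠ ⊤})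

/-- The length of `Ext^i_R(M, N)` as a natural number; meaningful for `i > fext R M N`. -/
def beta (i : ℕ) : ℕ := (extLength R M N i).toNat

/-- The complexity of the pair `(M, N)` (for `fext R M N < ⊤`): the infimum of the natural
numbers `b` such that for some real `a`, `beta n ≤ a * n ^ (b - 1)` for all `n ≫ 0`. -/
def cx : ℕ∞ :=
  sInf ((fun b : ℕ => (b : ℕ∞)) ''
    {b : ℕ | ∃ a : ℝ, ∀ᶠ n : ℕ in Filter.atTop,
      (beta R M N n : ℝ) ≤ a * (n : ℝ) ^ ((b : ℤ) - 1)})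

/-- `P(2i)` is the length of `Ext^{2i}_R(M, N)` for all `i ≫ 0`. -/
def IsEvenHilbertPolynomial (P : Polynomial ℚ) : Prop :=
  ∀ᶠ i : ℕ in Filter.atTop, P.eval ((2 * i : ℕ) : ℚ) = (beta R M N (2 * i) : ℚ)

/-- `P(2i+1)` is the length of `Ext^{2i+1}_R(M, N)` for all `i ≫ 0`. -/
def IsOddHilbertPolynomial (P : Polynomial ℚ) : Prop :=
  ∀ᶠ i : ℕ in Filter.atTop, P.eval ((2 * i + 1 : ℕ) : ℚ) = (beta R M N (2 * i + 1) : ℚ)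

open Classical in
/-- The even Hilbert polynomial of `(M, N)` (with value `0` if there is none). -/
def evenHilbertPolynomial : Polynomial ℚ :=
  if h : ∃ P, IsEvenHilbertPolynomial R M N P then h.choose else 0

open Classical in
/-- The odd Hilbert polynomial of `(M, N)` (with value `0` if there is none). -/
def oddHilbertPolynomial : Polynomial ℚ :=
  if h : ∃ P, IsOddHilbertPolynomial R M N P then h.choose else 0

/-- `h_R(M, N)`: with `r = cx_R(M, N)`, the difference of the coefficients of `t ^ (r - 1)` in the
even and in the odd Hilbert polynomial if `r > 0`, and `0` if `r = 0`. -/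
def hInvariant : ℚ :=
  if cx R M N = 0 then 0
  else (evenHilbertPolynomial R M N).coeff ((cx R M N).toNat - 1) -
    (oddHilbertPolynomial R M N).coeff ((cx R M N).toNat - 1)

/-- `M` has a rank: `K ⊗ M` is a free module of some finite rank over the total ring of
fractions `K` of `R`. -/
def HasARank : Prop :=
  ∃ n : ℕ, Nonempty
    (TensorProduct R (FractionRing R) M ≃ₗ[FractionRing R] (Fin n → FractionRing R))

end Pairs

section Graded

variable {k : Type u} [Field k] {σ : Type} (w : σ → ℕ) (I : Ideal (MvPolynomial σ k))

/-- An ideal of `k[x_s : s ∈ σ] / I`, with `x_s` in degree `w s`, is homogeneous if it is generated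
by (classes of) homogeneous elements. -/
def IsHomogeneousIdeal (J : Ideal (MvPolynomial σ k ⧸ I)) : Prop :=
  ∃ S : Set (MvPolynomial σ k), (∀ f ∈ S, ∃ n, IsWeightedHomogeneous w f n) ∧
    J = Ideal.span (Ideal.Quotient.mk I '' S)

/-- `k[x_s : s ∈ σ] / I`, with `x_s` in degree `w s`, is a graded complete intersection of
codimension `c`: the degrees `w s` are positive, `I ⊆ (x_s : s ∈ σ)²`, and `I` is generated
by a regular sequence of `c` homogeneous polynomials. -/
def IsGradedCompleteIntersection (c : ℕ) : Prop :=
  (∀ s, 0 < w s) ∧ I ≤ Ideal.span (Set.range X) ^ 2 ∧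
    ∃ f : Fin c → MvPolynomial σ k, (∀ i, ∃ n, IsWeightedHomogeneous w (f i) n) ∧
      RingTheory.Sequence.IsRegular (MvPolynomial σ k) (List.ofFn f) ∧
      I = Ideal.span (Set.range f)

/-- `R = k[x_s : s ∈ σ] / I` is regular in codimension `m`: the local ring `R_p` is regular
for every homogeneous prime ideal `p` with `dim R - dim R/p ≤ m`. -/
def IsRegularInCodim (m : ℕ) : Prop :=
  ∀ (p : Ideal (MvPolynomial σ k ⧸ I)) [p.IsPrime], IsHomogeneousIdeal w I p →
    ringKrullDim (MvPolynomial σ k ⧸ I) ≤ ringKrullDim ((MvPolynomial σ k ⧸ I) ⧸ p) + (m : ℕ∞) →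
    IsRegularLocalRing (Localization.AtPrime p)

end Graded

section Ring

variable (k : Type u) [Field k] (d : ℕ)

/-- The ideal `(x_1 x_{d+1}, …, x_d x_{2d})` of `k[x_1, …, x_{2d}]`; the variable `x_j` is
`X` of the index `j - 1`. -/
def relIdeal : Ideal (MvPolynomial (Fin (2 * d)) k) :=
  Ideal.span (Set.range fun i : Fin d =>
    (X ⟨i, by omega⟩ * X ⟨d + i, by omega⟩ : MvPolynomial (Fin (2 * d)) k))

/-- `R = k[x_1, …, x_{2d}] / (x_1 x_{d+1}, …, x_d x_{2d})`. -/
abbrev ExRing : Type u := MvPolynomial (Fin (2 * d)) k ⧸ relIdeal k d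

/-- The ideal of `R` generated by the classes of `x_1, …, x_r`. -/
def idealM (r : ℕ) : Ideal (ExRing k d) :=
  Ideal.span {y | ∃ j : Fin (2 * d), j.val < r ∧ y = Ideal.Quotient.mk (relIdeal k d) (X j)}

/-- The ideal of `R` generated by the classes of `x_{r+1}, …, x_{2d}`. -/
def idealN (r : ℕ) : Ideal (ExRing k d) :=
  Ideal.span {y | ∃ j : Fin (2 * d), r ≤ j.val ∧ y = Ideal.Quotient.mk (relIdeal k d) (X j)}

/-- The module `M = R / (x_1, …, x_r)`. -/
abbrev ModM (r : ℕ) : Type u := ExRing k d ⧸ idealM k d r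

/-- The module `N = R / (x_{r+1}, …, x_{2d})`. -/
abbrev ModN (r : ℕ) : Type u := ExRing k d ⧸ idealN k d r

end Ring

end ExtAsymptotics

end

/-! Write y_i for x_{d+i}, M_j = R/(x_1, …, x_j) and N_j = R/(x_{j+1}, …, x_{2d}), so that N_j is
the polynomial ring k[x_1, …, x_j]. The lengths e_j(n) of Ext^n(M_j, N_j) are computed exactly by
induction on j, starting from M_0 = R and N_0 = k.

Let x = x_{j+1} and y = y_{j+1}. On R and on M_j the annihilator of x is generated by y and vice
versa, and both kill N_j. Hence the long exact sequence of 0 → M_j/y → M_j → M_j/x → 0 splits into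
short ones, and Ext^n(M_{j+1}, N_j) has length e_j(0) + … + e_j(n)
(`IsExactPair.extLength_modSMul`). Next, x kills M_{j+1} and is regular on N_{j+1} with quotient
N_j, so the same length is e_{j+1}(n) + e_{j+1}(n+1) (`extLength_add_succ`), and e_{j+1}(0) = 0. On
generating functions the two steps multiply by 1/(1-t) and t/(1+t), so the series of e_j is
(t/(1-t²))^j: e_j(n) counts compositions of n into j odd parts (`extLength_modM_modN`).

Thus e_r vanishes in degrees of parity opposite to r and equals C(m+r-1, r-1) at n = r+2m. One
Hilbert polynomial is zero and the other has degree r-1, which gives both cx = r and h ≠ 0.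

The statements about R come from its minimal primes, generated by one variable from each pair {x_i,
y_i}. Localizing there gives a field. At (x_1, …, x_d, y_1), of height at most one, the relation x_1
y_1 = 0 leaves a node, whose maximal ideal is not principal. For r = d, the ideals defining M and N
are nonzero with nonzero annihilator, which excludes a rank. -/

namespace ExtAsymptotics

open CategoryTheory Abelian

noncomputable section

/-! ### Exact pairs of zero divisors and lifting of Ext classes. -/

section ExactPair

variable {R : Type u} [CommRing R]

/-- The annihilator of `x` in `L` is `yL` and the annihilator of `y` in `L` is `xL`. -/
structure IsExactPair (x y : R) (L : Type u) [AddCommGroup L] [Module R L] : Prop where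
  left : ∀ z : L, x • z = 0 → ∃ w : L, y • w = z
  right : ∀ z : L, y • z = 0 → ∃ w : L, x • w = z
  mul : ∀ z : L, x • y • z = 0

/-- The module `L / xL`. -/
abbrev ModSMul (x : R) (L : Type u) [AddCommGroup L] [Module R L] : Type u :=
  L ⧸ LinearMap.range (LinearMap.lsmul R L x)

variable {x y : R} {L : Type u} [AddCommGroup L] [Module R L]

lemma IsExactPair.symm (h : IsExactPair x y L) : IsExactPair y x L where
  left := h.right
  right := h.left
  mul z := by rw [smul_comm, h.mul]

lemma IsExactPair.finsupp (h : IsExactPair x y L) (ι : Type u) :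
    IsExactPair x y (ι →₀ L) := by
  have key : ∀ (x y : R), (∀ z : L, x • z = 0 → ∃ w : L, y • w = z) →
      ∀ z : ι →₀ L, x • z = 0 → ∃ w : ι →₀ L, y • w = z := by
    intro x y h z hz
    have h1 : ∀ i, ∃ w : L, y • w = z i := fun i => h (z i) (by
      simpa using DFunLike.congr_fun hz i)
    choose f hf using h1
    classical
    refine ⟨Finsupp.onFinset z.support (fun i => if z i = 0 then 0 else f i) ?_, ?_⟩
    · intro i hi
      by_contra h
      simp_all
    · ext i
      by_cases hi : z i = 0 <;> simp [hi, hf]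
  refine ⟨key x y h.left, key y x h.right, fun z => ?_⟩
  ext i
  simp [h.mul]

/-- Multiplication by `x`, as a map `L / yL → L`. -/
def IsExactPair.mulMap (h : IsExactPair x y L) : ModSMul y L →ₗ[R] L :=
  Submodule.liftQ _ (LinearMap.lsmul R L x) (by
    rintro _ ⟨z, rfl⟩
    simp [h.symm.mul])

lemma IsExactPair.mulMap_mk (h : IsExactPair x y L) (z : L) :
    h.mulMap (Submodule.Quotient.mk z) = x • z := rfl

lemma IsExactPair.mulMap_injective (h : IsExactPair x y L) : Function.Injective h.mulMap := by
  rw [injective_iff_map_eq_zero]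
  intro z hz
  obtain ⟨z, rfl⟩ := Submodule.Quotient.mk_surjective _ z
  rw [h.mulMap_mk] at hz
  obtain ⟨w, rfl⟩ := h.left z hz
  rw [Submodule.Quotient.mk_eq_zero]
  exact ⟨w, rfl⟩

lemma IsExactPair.exact_mulMap (h : IsExactPair x y L) :
    Function.Exact h.mulMap (LinearMap.range (LinearMap.lsmul R L x)).mkQ := by
  intro z
  rw [Submodule.mkQ_apply, Submodule.Quotient.mk_eq_zero]
  constructor
  · rintro ⟨w, rfl⟩
    exact ⟨Submodule.Quotient.mk w, rfl⟩
  · rintro ⟨w, rfl⟩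
    obtain ⟨w, rfl⟩ := Submodule.Quotient.mk_surjective _ w
    exact ⟨w, rfl⟩

variable {K F : Type u} [AddCommGroup K] [Module R K] [AddCommGroup F] [Module R F]

/-- If `K → F → L` is exact and `(x, y)` is an exact pair on `F` and `L`, an element of `K` that is
divisible by `y` in `F` is divisible by `y` in the image of `K`. -/
lemma IsExactPair.exists_of_exact (hF : IsExactPair x y F) (hL : IsExactPair x y L)
    (i : K →ₗ[R] F) (p : F →ₗ[R] L) (hp : Function.Surjective p)
    (hip : Function.Exact i p) (k : K) (f : F) (hk : i k = y • f) :
    ∃ k' : K, i k = y • i k' := by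
  have h0 : y • p f = 0 := by
    rw [← map_smul, ← hk]
    exact hip.apply_apply_eq_zero k
  obtain ⟨l, hl⟩ := hL.right _ h0
  obtain ⟨f', rfl⟩ := hp l
  obtain ⟨k', hk'⟩ := (hip (f - x • f')).1 (by rw [map_sub, map_smul, hl, sub_self])
  exact ⟨k', by rw [hk', smul_sub, hF.symm.mul, sub_zero, hk]⟩

/-- Exact pairs pass to syzygies, which is what makes dimension shifting possible in
`IsExactPair.ext_surjective`. -/
lemma IsExactPair.of_exact (hF : IsExactPair x y F) (hL : IsExactPair x y L)
    (i : K →ₗ[R] F) (p : F →ₗ[R] L) (hi : Function.Injective i) (hp : Function.Surjective p)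
    (hip : Function.Exact i p) : IsExactPair x y K := by
  have key : ∀ {x y : R}, IsExactPair x y F → IsExactPair x y L →
      ∀ z : K, x • z = 0 → ∃ w : K, y • w = z := by
    intro x y hF hL z hz
    obtain ⟨f, hf⟩ := hF.left (i z) (by rw [← map_smul, hz, map_zero])
    obtain ⟨k', hk'⟩ := exists_of_exact hF hL i p hp hip z f hf.symm
    exact ⟨k', hi (by rw [hk', map_smul])⟩
  exact ⟨key hF hL, key hF.symm hL.symm, fun z => hi (by
    rw [map_smul, map_smul, hF.mul, map_zero])⟩

/-- The map `K / yK → F / yF` induced by a linear map. -/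
def ModSMul.map (y : R) (i : K →ₗ[R] F) : ModSMul y K →ₗ[R] ModSMul y F :=
  Submodule.mapQ _ _ i (by
    rintro _ ⟨z, rfl⟩
    exact ⟨i z, by simp⟩)

lemma ModSMul.map_mk (y : R) (i : K →ₗ[R] F) (z : K) :
    ModSMul.map y i (Submodule.Quotient.mk z) = Submodule.Quotient.mk (i z) := rfl

/-- The short complex of `R`-modules given by an exact pair of linear maps. -/
abbrev shortComplexOfExact (i : K →ₗ[R] F) (p : F →ₗ[R] L) (hip : Function.Exact i p) :
    ShortComplex (ModuleCat.{u} R) :=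
  ShortComplex.mk (ModuleCat.ofHom i) (ModuleCat.ofHom p) (by
    ext z
    exact hip.apply_apply_eq_zero z)

lemma shortExact_of_exact (i : K →ₗ[R] F) (p : F →ₗ[R] L) (hi : Function.Injective i)
    (hp : Function.Surjective p) (hip : Function.Exact i p) :
    (shortComplexOfExact i p hip).ShortExact where
  exact := (ShortComplex.ShortExact.moduleCat_exact_iff_function_exact _).2 hip
  mono_f := (ModuleCat.mono_iff_injective _).2 hi
  epi_g := (ModuleCat.epi_iff_surjective _).2 hp

/-- This plays the role of the vanishing of Tor_1(L, R/y): a free cover of L stays short exact after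
reduction modulo y. -/
lemma IsExactPair.map_injective (hF : IsExactPair x y F) (hL : IsExactPair x y L)
    (i : K →ₗ[R] F) (p : F →ₗ[R] L) (hi : Function.Injective i) (hp : Function.Surjective p)
    (hip : Function.Exact i p) : Function.Injective (ModSMul.map y i) := by
  rw [injective_iff_map_eq_zero]
  intro z hz
  obtain ⟨z, rfl⟩ := Submodule.Quotient.mk_surjective _ z
  rw [ModSMul.map_mk, Submodule.Quotient.mk_eq_zero] at hz
  obtain ⟨f, hf⟩ := hz
  obtain ⟨k', hk'⟩ := exists_of_exact hF hL i p hp hip z f hf.symm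
  rw [Submodule.Quotient.mk_eq_zero]
  exact ⟨k', hi (by simp [hk'])⟩

lemma ModSMul.map_surjective (y : R) (p : F →ₗ[R] L) (hp : Function.Surjective p) :
    Function.Surjective (ModSMul.map y p) := by
  intro z
  obtain ⟨z, rfl⟩ := Submodule.Quotient.mk_surjective _ z
  obtain ⟨f, rfl⟩ := hp z
  exact ⟨Submodule.Quotient.mk f, rfl⟩

lemma ModSMul.map_exact (y : R) (i : K →ₗ[R] F) (p : F →ₗ[R] L) (hp : Function.Surjective p)
    (hip : Function.Exact i p) : Function.Exact (ModSMul.map y i) (ModSMul.map y p) := by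
  intro z
  obtain ⟨z, rfl⟩ := Submodule.Quotient.mk_surjective _ z
  rw [ModSMul.map_mk, Submodule.Quotient.mk_eq_zero]
  constructor
  · rintro ⟨l, hl⟩
    obtain ⟨f, rfl⟩ := hp l
    obtain ⟨k, hk⟩ := (hip (z - y • f)).1 (by
      rw [map_sub, map_smul, sub_eq_zero]
      exact hl.symm)
    refine ⟨Submodule.Quotient.mk k, ?_⟩
    rw [ModSMul.map_mk, hk, Submodule.Quotient.eq]
    exact ⟨-f, by simp⟩
  · rintro ⟨k, hk⟩
    obtain ⟨k, rfl⟩ := Submodule.Quotient.mk_surjective _ k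
    rw [ModSMul.map_mk, Submodule.Quotient.eq] at hk
    obtain ⟨f, hf⟩ := hk
    refine ⟨p (-f), ?_⟩
    have h1 : p (y • f) = p (i k - z) := congrArg p hf
    rw [map_sub, hip.apply_apply_eq_zero, map_smul] at h1
    simp [h1]

lemma exists_exact_finsupp (L : Type u) [AddCommGroup L] [Module R L] :
    ∃ (K : Type u) (_ : AddCommGroup K) (_ : Module R K) (i : K →ₗ[R] (L →₀ R))
      (p : (L →₀ R) →ₗ[R] L), Function.Injective i ∧ Function.Surjective p ∧
        Function.Exact i p :=
  ⟨LinearMap.ker (Finsupp.linearCombination R (id : L → L)), inferInstance, inferInstance,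
    Submodule.subtype _, Finsupp.linearCombination R id, Subtype.val_injective,
    Finsupp.linearCombination_id_surjective R L, LinearMap.exact_subtype_ker_map _⟩

/-- If `(x, y)` is an exact pair on `R` and on `L`, and `y` kills `N`, then
`Ext^n(L / yL, N) → Ext^n(L, N)` is surjective. -/
theorem IsExactPair.ext_surjective (hR : IsExactPair x y R) {N : Type u} [AddCommGroup N]
    [Module R N] (hN : ∀ z : N, y • z = 0) (n : ℕ) :
    ∀ {L : Type u} [AddCommGroup L] [Module R L], IsExactPair x y L →
    ∀ e : Ext (ModuleCat.of R L) (ModuleCat.of R N) n,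
    ∃ e' : Ext (ModuleCat.of R (ModSMul y L)) (ModuleCat.of R N) n,
      (Ext.mk₀ (ModuleCat.ofHom (LinearMap.range (LinearMap.lsmul R L y)).mkQ)).comp e'
        (zero_add n) = e := by
  induction n with
  | zero =>
    intro L _ _ hL e
    obtain ⟨f, rfl⟩ :=
      (Ext.addEquiv₀ (X := ModuleCat.of R L) (Y := ModuleCat.of R N)).symm.surjective e
    refine ⟨Ext.mk₀ (ModuleCat.ofHom (Submodule.liftQ _ f.hom ?_)), ?_⟩
    -- In degree zero, a homomorphism L → N kills yL because y kills N.
    · rintro _ ⟨z, rfl⟩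
      have : f.hom (y • z) = 0 := by rw [map_smul]; exact hN _
      simpa using this
    · rw [Ext.mk₀_comp_mk₀]
      rfl
  | succ n ih =>
    intro L _ _ hL e
    obtain ⟨K, _, _, i, p, hi, hp, hip⟩ := exists_exact_finsupp (R := R) L
    have hF : IsExactPair x y (L →₀ R) := hR.finsupp L
    have hK : IsExactPair x y K := hF.of_exact hL i p hi hp hip
    have h1 := shortExact_of_exact i p hi hp hip
    have h2 := shortExact_of_exact (ModSMul.map y i) (ModSMul.map y p)
      (hF.map_injective hL i p hi hp hip) (ModSMul.map_surjective y p hp)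
      (ModSMul.map_exact y i p hp hip)
    have : Projective (ModuleCat.of R (L →₀ R)) := ModuleCat.projective_of_free
      (Finsupp.basisSingleOne)
    -- Dimension shift: e comes from a class on the syzygy K. That class lifts to K/yK by induction,
    -- and the connecting class of the sequence reduced modulo y carries the lift to Ext^{n+1}(L/yL,
    -- N); naturality of connecting classes shows that it restricts to e.
    obtain ⟨e₁, he₁⟩ := Ext.contravariant_sequence_exact₃ h1 (ModuleCat.of R N) e
      (Ext.eq_zero_of_projective _) (add_comm 1 n)
    obtain ⟨e₂, rfl⟩ := ih hK e₁
    let φ : shortComplexOfExact i p hip ⟶ shortComplexOfExact (ModSMul.map y i) (ModSMul.map y p)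
        (ModSMul.map_exact y i p hp hip) :=
      { τ₁ := ModuleCat.ofHom (LinearMap.range (LinearMap.lsmul R _ y)).mkQ
        τ₂ := ModuleCat.ofHom (LinearMap.range (LinearMap.lsmul R _ y)).mkQ
        τ₃ := ModuleCat.ofHom (LinearMap.range (LinearMap.lsmul R _ y)).mkQ
        comm₁₂ := rfl
        comm₂₃ := rfl }
    have hnat := ShortComplex.ShortExact.extClass_naturality h1 h2 φ
    refine ⟨h2.extClass.comp e₂ (add_comm 1 n), ?_⟩
    rw [← he₁, ← Ext.comp_assoc (a₁₂ := 1) (a₂₃ := n) _ _ _ (by lia) (by lia) (by lia),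
      ← Ext.comp_assoc (a₁₂ := 1) (a₂₃ := n + 1) _ _ _ (by lia) (by lia) (by lia)]
    exact congrArg (fun z => Ext.comp z e₂ (add_comm 1 n)) hnat.symm

end ExactPair

/-! ### Length formulas from split-up long exact sequences. -/

section Length

variable {R : Type u} [CommRing R]

lemma extLength_congr_left {A A' N : Type u} [AddCommGroup A] [Module R A] [AddCommGroup A']
    [Module R A'] [AddCommGroup N] [Module R N] (e : A ≃ₗ[R] A') (n : ℕ) :
    extLength R A N n = extLength R A' N n := by
  have h1 : (ModuleCat.ofHom e.toLinearMap : ModuleCat.of R A ⟶ ModuleCat.of R A') ≫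
      ModuleCat.ofHom e.symm.toLinearMap = 𝟙 _ := by ext z; simp
  have h2 : (ModuleCat.ofHom e.symm.toLinearMap : ModuleCat.of R A' ⟶ ModuleCat.of R A) ≫
      ModuleCat.ofHom e.toLinearMap = 𝟙 _ := by ext z; simp
  refine LinearEquiv.length_eq (LinearEquiv.ofLinearMap
    (Ext.precompOfLinear (Ext.mk₀ (ModuleCat.ofHom e.symm.toLinearMap)) R _ (zero_add n))
    (Ext.precompOfLinear (Ext.mk₀ (ModuleCat.ofHom e.toLinearMap)) R _ (zero_add n)) ?_ ?_)
  · ext z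
    simp [h2]
  · ext z
    simp [h1]

/-- If `x` and `y` kill `N`, an exact pair `(x, y)` on `R` and `L` gives short exact sequences
`0 → Ext^n(L / yL, N) → Ext^{n+1}(L / xL, N) → Ext^{n+1}(L, N) → 0`. -/
lemma IsExactPair.extLength_succ {x y : R} (hR : IsExactPair x y R) {L N : Type u}
    [AddCommGroup L] [Module R L] [AddCommGroup N] [Module R N] (hL : IsExactPair x y L)
    (hx : ∀ z : N, x • z = 0) (n : ℕ) :
    extLength R (ModSMul x L) N (n + 1) =
      extLength R (ModSMul y L) N n + extLength R L N (n + 1) := by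
  have h1 := shortExact_of_exact hL.mulMap (LinearMap.range (LinearMap.lsmul R L x)).mkQ
    hL.mulMap_injective (Submodule.mkQ_surjective _) hL.exact_mulMap
  refine Module.length_eq_add_of_exact
    (Ext.precompOfLinear h1.extClass R (ModuleCat.of R N) (add_comm 1 n))
    (Ext.precompOfLinear (Ext.mk₀ (ModuleCat.ofHom (LinearMap.range (LinearMap.lsmul R L x)).mkQ))
      R (ModuleCat.of R N) (zero_add (n + 1))) ?_ ?_ ?_
  · rw [injective_iff_map_eq_zero]
    intro e he
    -- The connecting map is injective because Ext^n(L, N) → Ext^n(L/yL, N) is zero: every class on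
    -- L comes from L/xL, and L/yL → L → L/xL vanishes.
    obtain ⟨e₁, rfl⟩ := Ext.contravariant_sequence_exact₁ h1 (ModuleCat.of R N) e
      (add_comm 1 n) he
    obtain ⟨e₂, rfl⟩ := hR.symm.ext_surjective hx n hL.symm e₁
    have hz := (shortComplexOfExact hL.mulMap (LinearMap.range (LinearMap.lsmul R L x)).mkQ
      hL.exact_mulMap).zero
    rw [Ext.mk₀_comp_mk₀_assoc, hz, Ext.mk₀_zero, Ext.zero_comp]
  · exact fun e => hR.symm.ext_surjective hx (n + 1) hL.symm e
  · intro e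
    constructor
    · intro he
      exact Ext.contravariant_sequence_exact₃ h1 (ModuleCat.of R N) e he (add_comm 1 n)
    · rintro ⟨e, rfl⟩
      exact ShortComplex.ShortExact.comp_extClass_assoc h1 e (add_comm 1 n)

lemma extLength_zero_modSMul {x : R} {L N : Type u}
    [AddCommGroup L] [Module R L] [AddCommGroup N] [Module R N]
    (hx : ∀ z : N, x • z = 0) :
    extLength R (ModSMul x L) N 0 = extLength R L N 0 := by
  refine LinearEquiv.length_eq (LinearEquiv.ofBijective
    (Ext.precompOfLinear (Ext.mk₀ (ModuleCat.ofHom (LinearMap.range (LinearMap.lsmul R L x)).mkQ))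
      R (ModuleCat.of R N) (zero_add 0)) ⟨?_, ?_⟩)
  · have : Epi (ModuleCat.ofHom (LinearMap.range (LinearMap.lsmul R L x)).mkQ) :=
      (ModuleCat.epi_iff_surjective _).2 (Submodule.mkQ_surjective _)
    exact Ext.precomp_mk₀_injective_of_epi _ _
  · intro e
    obtain ⟨f, rfl⟩ :=
      (Ext.addEquiv₀ (X := ModuleCat.of R L) (Y := ModuleCat.of R N)).symm.surjective e
    refine ⟨Ext.mk₀ (ModuleCat.ofHom (Submodule.liftQ _ f.hom ?_)), ?_⟩
    · rintro _ ⟨z, rfl⟩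
      have : f.hom (x • z) = 0 := by rw [map_smul]; exact hx _
      simpa using this
    · exact Ext.mk₀_comp_mk₀ _ _

/-- The length of `Ext^n(L / xL, N)`, for an exact pair `(x, y)` killing `N`. -/
theorem IsExactPair.extLength_modSMul {x y : R} (hR : IsExactPair x y R) {L N : Type u}
    [AddCommGroup L] [Module R L] [AddCommGroup N] [Module R N] (hL : IsExactPair x y L)
    (hx : ∀ z : N, x • z = 0) (hy : ∀ z : N, y • z = 0) (n : ℕ) :
    extLength R (ModSMul x L) N n = ∑ i ∈ Finset.range (n + 1), extLength R L N i := by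
  induction n generalizing x y with
  | zero => simp [extLength_zero_modSMul hx]
  | succ n ih =>
    -- The roles of x and y alternate at each step, hence the induction generalizes over the pair.
    rw [hR.extLength_succ hL hx, ih hR.symm hL.symm hy hx, Finset.sum_range_succ _ (n + 1)]

lemma ext_smul_eq_zero {x : R} {A N : Type u} [AddCommGroup A] [Module R A] [AddCommGroup N]
    [Module R N] (hA : ∀ z : A, x • z = 0) {n : ℕ}
    (e : Ext (ModuleCat.of R A) (ModuleCat.of R N) n) : x • e = 0 := by
  have h1 : x • 𝟙 (ModuleCat.of R A) = 0 := by
    ext z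
    exact hA z
  rw [← Ext.mk₀_id_comp e, ← Ext.smul_comp, ← Ext.mk₀_smul, h1, Ext.mk₀_zero, Ext.zero_comp]

/-- If `x` kills `A`, is regular on `N` and `N' = N / xN`, there are short exact sequences
`0 → Ext^n(A, N) → Ext^n(A, N') → Ext^{n+1}(A, N) → 0`. -/
theorem extLength_add_succ {x : R} {A N N' : Type u} [AddCommGroup A] [Module R A]
    [AddCommGroup N] [Module R N] [AddCommGroup N'] [Module R N'] (hA : ∀ z : A, x • z = 0)
    (hN : ∀ z : N, x • z = 0 → z = 0) (p : N →ₗ[R] N') (hp : Function.Surjective p)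
    (hpx : ∀ z, p z = 0 ↔ ∃ w, x • w = z) (n : ℕ) :
    extLength R A N' n = extLength R A N n + extLength R A N (n + 1) := by
  have hip : Function.Exact (LinearMap.lsmul R N x) p := hpx
  have h1 := shortExact_of_exact (LinearMap.lsmul R N x) p
    ((injective_iff_map_eq_zero _).2 hN) hp hip
  -- Multiplication by x on N induces multiplication by x on Ext, which is zero since x kills A.
  -- This cuts the long exact sequence into short ones.
  have hzero : ∀ {m : ℕ} (e : Ext (ModuleCat.of R A) (ModuleCat.of R N) m),
      e.comp (Ext.mk₀ (ModuleCat.ofHom (LinearMap.lsmul R N x))) (add_zero m) = 0 := by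
    intro m e
    have h2 : ModuleCat.ofHom (LinearMap.lsmul R N x) = x • 𝟙 (ModuleCat.of R N) := by
      ext z
      rfl
    rw [h2, ← Ext.smul_eq_comp_mk₀, ext_smul_eq_zero hA]
  refine Module.length_eq_add_of_exact
    (Ext.postcompOfLinear (Ext.mk₀ (ModuleCat.ofHom p)) R (ModuleCat.of R A) (add_zero n))
    (Ext.postcompOfLinear h1.extClass R (ModuleCat.of R A) (rfl : n + 1 = n + 1)) ?_ ?_ ?_
  · rw [injective_iff_map_eq_zero]
    intro e he
    obtain ⟨e₁, rfl⟩ := Ext.covariant_sequence_exact₂ (ModuleCat.of R A) h1 e he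
    exact hzero e₁
  · exact fun e => Ext.covariant_sequence_exact₁ (ModuleCat.of R A) h1 e (hzero e) rfl
  · intro e
    constructor
    · exact fun he => Ext.covariant_sequence_exact₃ (ModuleCat.of R A) h1 e rfl he
    · rintro ⟨e, rfl⟩
      simp only [LinearMap.flip_apply, Ext.bilinearCompOfLinear_apply_apply]
      rw [Ext.comp_assoc_of_second_deg_zero, h1.comp_extClass, Ext.comp_zero]

lemma extLength_zero_eq_zero {x : R} {A N : Type u} [AddCommGroup A] [Module R A]
    [AddCommGroup N] [Module R N] (hA : ∀ z : A, x • z = 0)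
    (hN : ∀ z : N, x • z = 0 → z = 0) : extLength R A N 0 = 0 := by
  rw [extLength, Module.length_eq_zero_iff]
  refine subsingleton_of_forall_eq 0 fun e => ?_
  obtain ⟨f, rfl⟩ :=
    (Ext.addEquiv₀ (X := ModuleCat.of R A) (Y := ModuleCat.of R N)).symm.surjective e
  have : f = 0 := by
    ext z
    refine hN _ ?_
    rw [← map_smul]
    exact (congrArg f.hom (hA z)).trans (map_zero _)
  rw [this, map_zero]

lemma extLength_zero_of_self (N : Type u) [AddCommGroup N] [Module R N] :
    extLength R R N 0 = Module.length R N :=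
  LinearEquiv.length_eq ((Ext.linearEquiv₀ (R := R)).trans
    ((ModuleCat.homLinearEquiv (S := R)).trans (LinearMap.ringLmapEquivSelf R R N)))

lemma extLength_succ_of_self (N : Type u) [AddCommGroup N] [Module R N] (n : ℕ) :
    extLength R R N (n + 1) = 0 := by
  rw [extLength, Module.length_eq_zero_iff]
  have : Projective (ModuleCat.of R R) := ModuleCat.projective_of_free (Module.Basis.singleton Unit R)
  exact subsingleton_of_forall_eq 0 fun e => Ext.eq_zero_of_projective e

end Length

/-! ### Monomial ideals and the action of single variables. -/

section Monomial

open MvPolynomial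

variable (k : Type u) [Field k] {d : ℕ}

/-- The index of the variable `x_{i+1}`. -/
abbrev xIdx (i : Fin d) : Fin (2 * d) := ⟨i, by omega⟩

/-- The index of the variable `x_{d+i+1}`. -/
abbrev yIdx (i : Fin d) : Fin (2 * d) := ⟨d + i, by omega⟩

lemma xIdx_ne_yIdx (i j : Fin d) : xIdx i ≠ yIdx j := by
  intro h
  have := congrArg Fin.val h
  simp only at this
  omega

lemma xIdx_or_yIdx (j : Fin (2 * d)) : (∃ i, j = xIdx i) ∨ ∃ i, j = yIdx i := by
  by_cases h : j.val < d
  · exact Or.inl ⟨⟨j, h⟩, rfl⟩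
  · refine Or.inr ⟨⟨j - d, by omega⟩, ?_⟩
    ext
    simp only
    omega

/-- The ideal of the polynomial ring generated by the variables in `A` and the products
`x_i x_{d+i}` with `i` in `B`. -/
def monoIdeal (A : Set (Fin (2 * d))) (B : Set (Fin d)) : Ideal (MvPolynomial (Fin (2 * d)) k) :=
  Ideal.span (X '' A ∪ (fun i => X (xIdx i) * X (yIdx i)) '' B)

variable {k}

lemma mem_monoIdeal {A : Set (Fin (2 * d))} {B : Set (Fin d)}
    {f : MvPolynomial (Fin (2 * d)) k} :
    f ∈ monoIdeal k A B ↔ ∀ m ∈ f.support,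
      (∃ j ∈ A, m j ≠ 0) ∨ ∃ i ∈ B, m (xIdx i) ≠ 0 ∧ m (yIdx i) ≠ 0 := by
  have h1 : monoIdeal k A B = Ideal.span ((fun s => monomial s (1 : k)) ''
      ((fun j => Finsupp.single j 1) '' A ∪
        (fun i => Finsupp.single (xIdx i) 1 + Finsupp.single (yIdx i) 1) '' B)) := by
    rw [monoIdeal, Set.image_union, Set.image_image, Set.image_image]
    congr 3
    ext i : 1
    rw [X, X, monomial_mul, one_mul]
  rw [h1, mem_ideal_span_monomial_image]
  refine forall₂_congr fun m _ => ?_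
  have h2 : ∀ j : Fin (2 * d), Finsupp.single j 1 ≤ m ↔ m j ≠ 0 := fun j => by
    rw [Finsupp.single_le_iff, Nat.one_le_iff_ne_zero]
  have h3 : ∀ i : Fin d, Finsupp.single (xIdx i) 1 + Finsupp.single (yIdx i) 1 ≤ m ↔
      m (xIdx i) ≠ 0 ∧ m (yIdx i) ≠ 0 := by
    intro i
    constructor
    · intro h
      exact ⟨(h2 _).1 (le_self_add.trans h), (h2 _).1 (le_add_self.trans h)⟩
    · rintro ⟨hx, hy⟩ j
      have := xIdx_ne_yIdx i i
      by_cases h4 : j = xIdx i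
      · subst h4
        simp [this.symm]
        omega
      · by_cases h5 : j = yIdx i
        · subst h5
          simp [this]
          omega
        · simp [Ne.symm h4, Ne.symm h5]
  simp only [Set.mem_union, Set.mem_image, or_and_right, exists_or, exists_exists_and_eq_and,
    h2, h3]

/-- Multiplying by a variable only shifts exponents, so colon ideals by a variable can be read off
monomial by monomial. -/
lemma X_mul_mem_monoIdeal {A : Set (Fin (2 * d))} {B : Set (Fin d)}
    {f : MvPolynomial (Fin (2 * d)) k} (j : Fin (2 * d)) :
    X j * f ∈ monoIdeal k A B ↔ ∀ m ∈ f.support,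
      (∃ l ∈ A, (m l ≠ 0 ∨ l = j)) ∨ ∃ i ∈ B, (m (xIdx i) ≠ 0 ∨ xIdx i = j) ∧
        (m (yIdx i) ≠ 0 ∨ yIdx i = j) := by
  have h1 : ∀ (m : Fin (2 * d) →₀ ℕ) l, (Finsupp.single j 1 + m : Fin (2 * d) →₀ ℕ) l ≠ 0 ↔ (m l ≠ 0 ∨ l = j) := by
    intro m l
    by_cases h : l = j
    · simp [h]
    · simp [h]
  rw [mem_monoIdeal, support_X_mul]
  simp only [Finset.mem_map, addLeftEmbedding_apply, forall_exists_index, and_imp,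
    forall_apply_eq_imp_iff₂, h1]

lemma relIdeal_eq_monoIdeal : relIdeal k d = monoIdeal k ∅ Set.univ := by
  simp [relIdeal, monoIdeal, Set.image_univ]

variable (k) in
/-- The ideal of `R` generated by the variables in `A`. -/
def varIdeal (A : Set (Fin (2 * d))) : Ideal (ExRing k d) :=
  Ideal.span {y | ∃ j : Fin (2 * d), j ∈ A ∧ y = Ideal.Quotient.mk (relIdeal k d) (X j)}

lemma idealM_eq_varIdeal (r : ℕ) : idealM k d r = varIdeal k {j | j.val < r} := rfl

lemma idealN_eq_varIdeal (r : ℕ) : idealN k d r = varIdeal k {j | r ≤ j.val} := rfl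

variable (k) in
/-- The class of a variable in `R`. -/
abbrev xbar (j : Fin (2 * d)) : ExRing k d := Ideal.Quotient.mk (relIdeal k d) (X j)

lemma xbar_mul (i : Fin d) : xbar k (xIdx i) * xbar k (yIdx i) = 0 := by
  rw [← map_mul, Ideal.Quotient.eq_zero_iff_mem]
  exact Ideal.subset_span ⟨i, rfl⟩

lemma varIdeal_eq_map (A : Set (Fin (2 * d))) :
    varIdeal k A = (Ideal.span (X '' A)).map (Ideal.Quotient.mk (relIdeal k d)) := by
  rw [varIdeal, Ideal.map_span]
  congr 1
  ext y
  simp [eq_comm]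

lemma mk_mem_varIdeal {A : Set (Fin (2 * d))} {f : MvPolynomial (Fin (2 * d)) k} :
    Ideal.Quotient.mk (relIdeal k d) f ∈ varIdeal k A ↔ f ∈ monoIdeal k A Set.univ := by
  rw [varIdeal_eq_map, ← Ideal.mem_comap, Ideal.comap_map_of_surjective' _
    Ideal.Quotient.mk_surjective, Ideal.mk_ker, monoIdeal, Ideal.span_union, Set.image_univ]
  rfl

lemma varIdeal_mono {A B : Set (Fin (2 * d))} (h : A ⊆ B) : varIdeal k A ≤ varIdeal k B :=
  Ideal.span_mono fun _ ⟨j, hj, e⟩ => ⟨j, h hj, e⟩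

lemma xbar_mem_varIdeal {A : Set (Fin (2 * d))} {j : Fin (2 * d)} :
    xbar k j ∈ varIdeal k A ↔ j ∈ A := by
  constructor
  · intro h
    rw [mk_mem_varIdeal, mem_monoIdeal] at h
    have h1 := h (Finsupp.single j 1) (by simp [support_X])
    simp only [Finsupp.single_apply, ne_eq, ite_eq_right_iff, one_ne_zero, imp_false, not_not,
      exists_eq_right', Set.mem_univ, true_and] at h1
    rcases h1 with h1 | ⟨i, h1, h2⟩
    · exact h1
    · exact absurd (h1.symm.trans h2) (xIdx_ne_yIdx i i)
  · exact fun h => Ideal.subset_span ⟨j, h, rfl⟩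

lemma varIdeal_insert (A : Set (Fin (2 * d))) (j : Fin (2 * d)) :
    varIdeal k (insert j A) = Ideal.span {xbar k j} ⊔ varIdeal k A := by
  rw [varIdeal, varIdeal, ← Ideal.span_union]
  congr 1
  ext y
  simp

lemma mem_varIdeal_insert {A : Set (Fin (2 * d))} {j : Fin (2 * d)} {z : ExRing k d} :
    z ∈ varIdeal k (insert j A) ↔ ∃ w, xbar k j * w - z ∈ varIdeal k A := by
  rw [varIdeal_insert, Submodule.mem_sup]
  constructor
  · rintro ⟨y, hy, z', hz', rfl⟩
    obtain ⟨w, rfl⟩ := Ideal.mem_span_singleton'.1 hy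
    refine ⟨w, ?_⟩
    convert (varIdeal k A).neg_mem hz' using 1
    ring
  · rintro ⟨w, hw⟩
    refine ⟨xbar k j * w, Ideal.mul_mem_right _ _ (Ideal.mem_span_singleton_self _),
      z - xbar k j * w, ?_, by ring⟩
    convert (varIdeal k A).neg_mem hw using 1
    ring

lemma varIdeal_empty : varIdeal k (∅ : Set (Fin (2 * d))) = ⊥ := by
  simp [varIdeal]

lemma IsExactPair.of_equiv {R : Type u} [CommRing R] {x y : R} {L L' : Type u} [AddCommGroup L]
    [Module R L] [AddCommGroup L'] [Module R L'] (h : IsExactPair x y L) (e : L ≃ₗ[R] L') :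
    IsExactPair x y L' where
  left z hz := by
    obtain ⟨w, hw⟩ := h.left (e.symm z) (by rw [← map_smul, hz, map_zero])
    exact ⟨e w, by rw [← map_smul, hw, e.apply_symm_apply]⟩
  right z hz := by
    obtain ⟨w, hw⟩ := h.right (e.symm z) (by rw [← map_smul, hz, map_zero])
    exact ⟨e w, by rw [← map_smul, hw, e.apply_symm_apply]⟩
  mul z := by
    rw [← e.apply_symm_apply z, ← map_smul, ← map_smul, h.mul, map_zero]

/-- If neither variable of the pair lies in A, the only generator of the defining monomial ideal
involving one of them is their product. So a monomial that becomes zero after multiplication by one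
was already zero or is divisible by the other. -/
lemma isExactPair_varIdeal {A : Set (Fin (2 * d))} (i : Fin d) (hx : xIdx i ∉ A)
    (hy : yIdx i ∉ A) :
    IsExactPair (xbar k (xIdx i)) (xbar k (yIdx i)) (ExRing k d ⧸ varIdeal k A) := by
  have key : ∀ a b : Fin (2 * d), ((a = xIdx i ∧ b = yIdx i) ∨ (a = yIdx i ∧ b = xIdx i)) →
      a ∉ A → ∀ z : ExRing k d ⧸ varIdeal k A, xbar k a • z = 0 → ∃ w, xbar k b • w = z := by
    intro a b hab ha z hz
    obtain ⟨z, rfl⟩ := Ideal.Quotient.mk_surjective z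
    obtain ⟨f, rfl⟩ := Ideal.Quotient.mk_surjective z
    have h1 : xbar k a * Ideal.Quotient.mk (relIdeal k d) f ∈ varIdeal k A :=
      Ideal.Quotient.eq_zero_iff_mem.1 hz
    rw [← map_mul, mk_mem_varIdeal, X_mul_mem_monoIdeal] at h1
    have h2 : Ideal.Quotient.mk (relIdeal k d) f ∈ varIdeal k (insert b A) := by
      rw [mk_mem_varIdeal, mem_monoIdeal]
      intro m hm
      rcases h1 m hm with ⟨l, hl, h | rfl⟩ | ⟨l, -, h⟩
      · exact Or.inl ⟨l, Set.mem_insert_of_mem _ hl, h⟩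
      · exact absurd hl ha
      · by_cases hmb : m b = 0
        · refine Or.inr ⟨l, trivial, ?_⟩
          by_cases hli : l = i
          · subst hli
            have := xIdx_ne_yIdx l l
            rcases hab with ⟨rfl, rfl⟩ | ⟨rfl, rfl⟩
            · rcases h with ⟨-, h | h⟩
              · exact absurd hmb h
              · exact absurd h.symm this
            · rcases h with ⟨h | h, -⟩
              · exact absurd hmb h
              · exact absurd h this
          · have h3 : xIdx l ≠ a := by
              rcases hab with ⟨rfl, rfl⟩ | ⟨rfl, rfl⟩
              · simp only [ne_eq, Fin.mk.injEq]
                omega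
              · exact xIdx_ne_yIdx _ _
            have h4 : yIdx l ≠ a := by
              rcases hab with ⟨rfl, rfl⟩ | ⟨rfl, rfl⟩
              · exact (xIdx_ne_yIdx _ _).symm
              · simp only [ne_eq, Fin.mk.injEq]
                omega
            simpa [h3, h4] using h
        · exact Or.inl ⟨b, Set.mem_insert _ _, hmb⟩
    obtain ⟨w, hw⟩ := mem_varIdeal_insert.1 h2
    exact ⟨Ideal.Quotient.mk _ w, Ideal.Quotient.eq.2 hw⟩
  refine ⟨key _ _ (Or.inl ⟨rfl, rfl⟩) hx, key _ _ (Or.inr ⟨rfl, rfl⟩) hy, fun z => ?_⟩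
  rw [smul_smul, xbar_mul]
  exact zero_smul (ExRing k d) z

lemma isExactPair_exRing (i : Fin d) :
    IsExactPair (xbar k (xIdx i)) (xbar k (yIdx i)) (ExRing k d) :=
  (isExactPair_varIdeal (A := ∅) i (by simp) (by simp)).of_equiv
    (Submodule.quotEquivOfEqBot _ varIdeal_empty)

/-- The projection `R / I_A → R / I_B` for `A ⊆ B`. -/
def varFactor {A B : Set (Fin (2 * d))} (h : A ⊆ B) :
    (ExRing k d ⧸ varIdeal k A) →ₗ[ExRing k d] (ExRing k d ⧸ varIdeal k B) :=
  Submodule.factor (varIdeal_mono h)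

lemma varFactor_surjective {A B : Set (Fin (2 * d))} (h : A ⊆ B) :
    Function.Surjective (varFactor (k := k) h) :=
  Submodule.factor_surjective (varIdeal_mono h)

lemma varFactor_insert_eq_zero {A : Set (Fin (2 * d))} {j : Fin (2 * d)}
    (z : ExRing k d ⧸ varIdeal k A) :
    varFactor (Set.subset_insert j A) z = 0 ↔ ∃ w, xbar k j • w = z := by
  obtain ⟨z, rfl⟩ := Ideal.Quotient.mk_surjective z
  have h1 : varFactor (Set.subset_insert j A) (Ideal.Quotient.mk (varIdeal k A) z) = 0 ↔
      z ∈ varIdeal k (insert j A) := Ideal.Quotient.eq_zero_iff_mem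
  rw [h1, mem_varIdeal_insert]
  constructor
  · rintro ⟨w, hw⟩
    exact ⟨Ideal.Quotient.mk _ w, Ideal.Quotient.eq.2 hw⟩
  · rintro ⟨w, hw⟩
    obtain ⟨w, rfl⟩ := Ideal.Quotient.mk_surjective w
    exact ⟨w, Ideal.Quotient.eq.1 hw⟩

/-- `R / I_{A ∪ {j}}` is the quotient of `R / I_A` by the multiples of the variable `x_j`. -/
def modSMulEquiv (A : Set (Fin (2 * d))) (j : Fin (2 * d)) :
    ModSMul (xbar k j) (ExRing k d ⧸ varIdeal k A) ≃ₗ[ExRing k d]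
      (ExRing k d ⧸ varIdeal k (insert j A)) :=
  (Submodule.quotEquivOfEq _ _ (by
    ext z
    rw [LinearMap.mem_ker, varFactor_insert_eq_zero]
    rfl)).trans ((varFactor (Set.subset_insert j A)).quotKerEquivOfSurjective
      (varFactor_surjective _))

lemma xbar_smul_eq_zero {A : Set (Fin (2 * d))} {j : Fin (2 * d)} (hj : j ∈ A)
    (z : ExRing k d ⧸ varIdeal k A) : xbar k j • z = 0 := by
  obtain ⟨z, rfl⟩ := Ideal.Quotient.mk_surjective z
  exact Ideal.Quotient.eq_zero_iff_mem.2 (Ideal.mul_mem_right _ _ (xbar_mem_varIdeal.2 hj))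

/-- Once y_i is killed the relation x_i y_i = 0 becomes vacuous, so x_i occurs in no remaining
generator and is a nonzerodivisor. -/
lemma eq_zero_of_xbar_smul {A : Set (Fin (2 * d))} {i : Fin d} (hx : xIdx i ∉ A)
    (hy : yIdx i ∈ A) (z : ExRing k d ⧸ varIdeal k A) (hz : xbar k (xIdx i) • z = 0) : z = 0 := by
  obtain ⟨z, rfl⟩ := Ideal.Quotient.mk_surjective z
  obtain ⟨f, rfl⟩ := Ideal.Quotient.mk_surjective z
  have h1 : xbar k (xIdx i) * Ideal.Quotient.mk (relIdeal k d) f ∈ varIdeal k A :=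
    Ideal.Quotient.eq_zero_iff_mem.1 hz
  rw [← map_mul, mk_mem_varIdeal, X_mul_mem_monoIdeal] at h1
  rw [Ideal.Quotient.eq_zero_iff_mem, mk_mem_varIdeal, mem_monoIdeal]
  intro m hm
  rcases h1 m hm with ⟨l, hl, h | rfl⟩ | ⟨l, -, h⟩
  · exact Or.inl ⟨l, hl, h⟩
  · exact absurd hl hx
  · have h4 : m (yIdx l) ≠ 0 := h.2.resolve_right (xIdx_ne_yIdx _ _).symm
    rcases h.1 with h5 | h5
    · exact Or.inr ⟨l, trivial, h5, h4⟩
    · have h6 : l = i := by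
        simpa [Fin.ext_iff] using h5
      exact Or.inl ⟨yIdx l, h6 ▸ hy, h4⟩

end Monomial

/-! ### The two steps of the recursion in j. -/

section Recursion

variable {k : Type u} [Field k] {d : ℕ}

lemma setOf_lt_succ {j : ℕ} (hj : j < d) :
    {l : Fin (2 * d) | l.val < j + 1} = insert (xIdx ⟨j, hj⟩) {l | l.val < j} := by
  ext l
  simp only [Set.mem_ofPred_eq, Set.mem_insert_iff, Fin.ext_iff]
  omega

lemma setOf_le_eq_insert {j : ℕ} (hj : j < d) :
    {l : Fin (2 * d) | j ≤ l.val} = insert (xIdx ⟨j, hj⟩) {l | j + 1 ≤ l.val} := by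
  ext l
  simp only [Set.mem_ofPred_eq, Set.mem_insert_iff, Fin.ext_iff]
  omega

/-- `Ext^n(M_{j+1}, N_j)` in terms of the `Ext^i(M_j, N_j)`. -/
lemma extLength_modM_succ_modN {j : ℕ} (hj : j < d) (n : ℕ) :
    extLength (ExRing k d) (ModM k d (j + 1)) (ModN k d j) n =
      ∑ i ∈ Finset.range (n + 1), extLength (ExRing k d) (ModM k d j) (ModN k d j) i := by
  have e : ModSMul (xbar k (xIdx ⟨j, hj⟩)) (ModM k d j) ≃ₗ[ExRing k d] ModM k d (j + 1) :=
    (modSMulEquiv {l | l.val < j} (xIdx ⟨j, hj⟩)).trans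
      (Submodule.quotEquivOfEq _ _ (by rw [← setOf_lt_succ]; rfl))
  rw [← extLength_congr_left e]
  refine (isExactPair_exRing ⟨j, hj⟩).extLength_modSMul
    (isExactPair_varIdeal (A := {l | l.val < j}) ⟨j, hj⟩ (by simp) ?_)
    (xbar_smul_eq_zero (A := {l | j ≤ l.val}) (by simp))
    (xbar_smul_eq_zero (A := {l | j ≤ l.val}) ?_) n
  · simp only [Set.mem_ofPred_eq, yIdx]
    omega
  · simp only [Set.mem_ofPred_eq, yIdx]
    omega

/-- The variable x_{j+1} kills M_{j+1} and is regular on N_{j+1}, because y_{j+1} is already zero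
there; its cokernel on N_{j+1} is N_j. -/
lemma extLength_modN_add {j : ℕ} (hj : j < d) (n : ℕ) :
    extLength (ExRing k d) (ModM k d (j + 1)) (ModN k d j) n =
      extLength (ExRing k d) (ModM k d (j + 1)) (ModN k d (j + 1)) n +
      extLength (ExRing k d) (ModM k d (j + 1)) (ModN k d (j + 1)) (n + 1) := by
  let p : ModN k d (j + 1) →ₗ[ExRing k d] ModN k d j :=
    varFactor (A := {l | j + 1 ≤ l.val}) (B := {l | j ≤ l.val}) (by
      rw [setOf_le_eq_insert hj]
      exact Set.subset_insert _ _)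
  refine extLength_add_succ (x := xbar k (xIdx ⟨j, hj⟩))
    (xbar_smul_eq_zero (A := {l | l.val < j + 1}) (by simp))
    (eq_zero_of_xbar_smul (A := {l | j + 1 ≤ l.val}) (by simp) ?_) p (varFactor_surjective _) ?_ n
  · simp only [Set.mem_ofPred_eq, yIdx]
    omega
  · intro z
    refine Iff.trans ?_ (varFactor_insert_eq_zero (A := {l | j + 1 ≤ l.val}) z)
    obtain ⟨z, rfl⟩ := Ideal.Quotient.mk_surjective z
    have h1 : p (Ideal.Quotient.mk _ z) = 0 ↔ z ∈ varIdeal k {l | j ≤ l.val} :=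
      Ideal.Quotient.eq_zero_iff_mem
    rw [h1, setOf_le_eq_insert hj]
    exact Ideal.Quotient.eq_zero_iff_mem.symm

lemma extLength_modM_succ_zero {j : ℕ} (hj : j < d) :
    extLength (ExRing k d) (ModM k d (j + 1)) (ModN k d (j + 1)) 0 = 0 := by
  refine extLength_zero_eq_zero (x := xbar k (xIdx ⟨j, hj⟩))
    (xbar_smul_eq_zero (A := {l | l.val < j + 1}) (by simp))
    (eq_zero_of_xbar_smul (A := {l | j + 1 ≤ l.val}) (by simp) ?_)
  simp only [Set.mem_ofPred_eq, yIdx]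
  omega

end Recursion

/-! ### Transversals, minimal primes and dimensions. -/

section Transversal

open MvPolynomial

variable {k : Type u} [Field k] {d : ℕ}

/-- The evaluation killing the variables in `A`. -/
def killVars (k : Type u) [Field k] {σ : Type} (A : Set σ) :
    MvPolynomial σ k →ₐ[k] MvPolynomial {j // j ∉ A} k :=
  open Classical in aeval fun j => if h : j ∈ A then 0 else X ⟨j, h⟩

lemma killVars_X_of_mem {σ : Type} {A : Set σ} {j : σ} (h : j ∈ A) : killVars k A (X j) = 0 := by
  simp [killVars, h]

lemma killVars_X_of_notMem {σ : Type} {A : Set σ} {j : σ} (h : j ∉ A) :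
    killVars k A (X j) = X ⟨j, h⟩ := by
  simp [killVars, h]

lemma killVars_rename {σ : Type} {A : Set σ} (f : MvPolynomial {j // j ∉ A} k) :
    killVars k A (rename (↑) f) = f := by
  have : (killVars k A).comp (rename (R := k) (Subtype.val : {j // j ∉ A} → σ)) =
      AlgHom.id k _ := by
    ext j : 1
    simp [killVars_X_of_notMem j.2]
  exact DFunLike.congr_fun this f

/-- Modulo the variables in A, `killVars` followed by `rename` is the identity, so nothing else can
lie in the kernel. -/
lemma ker_killVars {σ : Type} (A : Set σ) :
    RingHom.ker (killVars k A) = Ideal.span (X '' A) := by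
  apply le_antisymm
  · intro f hf
    have h1 : ((Ideal.Quotient.mkₐ k (Ideal.span (X '' A : Set (MvPolynomial σ k)))).comp
        (rename (R := k) (Subtype.val : {j // j ∉ A} → σ))).comp (killVars k A) =
        Ideal.Quotient.mkₐ k (Ideal.span (X '' A)) := by
      ext j : 1
      by_cases h : j ∈ A
      · have h2 : (X j : MvPolynomial σ k) ∈ Ideal.span (X '' A : Set (MvPolynomial σ k)) :=
          Ideal.subset_span ⟨j, h, rfl⟩
        simp [killVars_X_of_mem h, Ideal.Quotient.eq_zero_iff_mem.2 h2]
      · simp [killVars_X_of_notMem h]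
    have h2 := DFunLike.congr_fun h1 f
    simp only [AlgHom.comp_apply, (RingHom.mem_ker).1 hf, map_zero] at h2
    exact Ideal.Quotient.eq_zero_iff_mem.1 h2.symm
  · rw [Ideal.span_le]
    rintro _ ⟨j, hj, rfl⟩
    exact killVars_X_of_mem hj

/-- A set of variables meeting every pair `{x_i, x_{d+i}}`. -/
def IsTransversal (A : Set (Fin (2 * d))) : Prop := ∀ i : Fin d, xIdx i ∈ A ∨ yIdx i ∈ A

lemma IsTransversal.relIdeal_le {A : Set (Fin (2 * d))} (h : IsTransversal A) :
    relIdeal k d ≤ RingHom.ker (killVars k A) := by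
  rw [relIdeal, Ideal.span_le]
  rintro _ ⟨i, rfl⟩
  have h1 : killVars k A (X (xIdx i) * X (yIdx i)) = 0 := by
    rw [map_mul]
    rcases h i with h | h
    · rw [killVars_X_of_mem h, zero_mul]
    · rw [killVars_X_of_mem h, mul_zero]
  exact h1

/-- For a transversal `A`, the map from `R` to the polynomial ring in the remaining variables. -/
def IsTransversal.eval {A : Set (Fin (2 * d))} (h : IsTransversal A) :
    ExRing k d →+* MvPolynomial {j // j ∉ A} k :=
  Ideal.Quotient.lift _ (killVars k A : MvPolynomial (Fin (2 * d)) k →+* _)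
    fun _ hf => RingHom.mem_ker.1 (h.relIdeal_le hf)

lemma IsTransversal.eval_surjective {A : Set (Fin (2 * d))} (h : IsTransversal A) :
    Function.Surjective (h.eval (k := k)) := by
  intro f
  refine ⟨Ideal.Quotient.mk _ (rename (↑) f), ?_⟩
  exact (Ideal.Quotient.lift_mk _ _ _).trans (killVars_rename f)

lemma IsTransversal.ker_eval {A : Set (Fin (2 * d))} (h : IsTransversal A) :
    RingHom.ker (h.eval (k := k)) = varIdeal k A := by
  rw [varIdeal_eq_map, ← ker_killVars]
  exact Ideal.ker_quotient_lift _ _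

/-- For a transversal `A`, the quotient `R / I_A` is a polynomial ring. -/
def IsTransversal.equiv {A : Set (Fin (2 * d))} (h : IsTransversal A) :
    (ExRing k d ⧸ varIdeal k A) ≃+* MvPolynomial {j // j ∉ A} k :=
  (Ideal.quotEquivOfEq h.ker_eval.symm).trans
    (RingHom.quotientKerEquivOfSurjective h.eval_surjective)

lemma IsTransversal.isPrime {A : Set (Fin (2 * d))} (h : IsTransversal A) :
    (varIdeal k A).IsPrime := by
  rw [← h.ker_eval]
  exact RingHom.ker_isPrime _

lemma IsTransversal.ringKrullDim {A : Set (Fin (2 * d))} (h : IsTransversal A) :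
    ringKrullDim (ExRing k d ⧸ varIdeal k A) = (Nat.card {j // j ∉ A} : ℕ) := by
  rw [ringKrullDim_eq_of_ringEquiv h.equiv, MvPolynomial.ringKrullDim_of_isNoetherianRing,
    ringKrullDim_eq_zero_of_field, zero_add]

/-- The transversal with `x_i` for `i` in `c` and `x_{d+i}` for `i` not in `c`. -/
def choiceSet (c : Set (Fin d)) : Set (Fin (2 * d)) := xIdx '' c ∪ yIdx '' cᶜ

lemma xIdx_injective : Function.Injective (xIdx (d := d)) := fun i j h => by
  simpa [Fin.ext_iff] using h

lemma yIdx_injective : Function.Injective (yIdx (d := d)) := fun i j h => by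
  simpa [Fin.ext_iff] using h

lemma xIdx_mem_choiceSet {c : Set (Fin d)} {i : Fin d} : xIdx i ∈ choiceSet c ↔ i ∈ c := by
  have h : ∀ j, yIdx j ≠ xIdx i := fun j => (xIdx_ne_yIdx i j).symm
  simp only [choiceSet, Set.mem_union, Set.mem_image, xIdx_injective.eq_iff, exists_eq_right, h,
    and_false, exists_false, or_false]

lemma yIdx_mem_choiceSet {c : Set (Fin d)} {i : Fin d} : yIdx i ∈ choiceSet c ↔ i ∉ c := by
  have h : ∀ j, xIdx j ≠ yIdx i := fun j => xIdx_ne_yIdx j i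
  simp only [choiceSet, Set.mem_union, Set.mem_image, yIdx_injective.eq_iff, exists_eq_right, h,
    and_false, exists_false, false_or, Set.mem_compl_iff]

lemma isTransversal_choiceSet (c : Set (Fin d)) : IsTransversal (choiceSet c) := by
  intro i
  rw [xIdx_mem_choiceSet, yIdx_mem_choiceSet]
  exact em _

lemma card_compl_choiceSet (c : Set (Fin d)) : Nat.card {j // j ∉ choiceSet c} = d := by
  classical
  have h : ∀ i : Fin d, (if i ∈ c then yIdx i else xIdx i) ∉ choiceSet c := by
    intro i
    split_ifs with h
    · simpa [yIdx_mem_choiceSet] using h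
    · simpa [xIdx_mem_choiceSet] using h
  have e : Function.Bijective
      (fun i : Fin d => (⟨if i ∈ c then yIdx i else xIdx i, h i⟩ : {j // j ∉ choiceSet c})) := by
    constructor
    · intro i j hij
      have hij : (if i ∈ c then yIdx i else xIdx i) = if j ∈ c then yIdx j else xIdx j :=
        congrArg Subtype.val hij
      split_ifs at hij
      · exact yIdx_injective hij
      · exact absurd hij.symm (xIdx_ne_yIdx _ _)
      · exact absurd hij (xIdx_ne_yIdx _ _)
      · exact xIdx_injective hij
    · rintro ⟨j, hj⟩
      rcases xIdx_or_yIdx j with ⟨i, rfl⟩ | ⟨i, rfl⟩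
      · refine ⟨i, Subtype.ext ?_⟩
        rw [xIdx_mem_choiceSet] at hj
        simp [hj]
      · refine ⟨i, Subtype.ext ?_⟩
        rw [yIdx_mem_choiceSet, not_not] at hj
        simp [hj]
  rw [← Nat.card_eq_of_bijective _ e, Nat.card_fin]

lemma ringKrullDim_choiceSet (c : Set (Fin d)) :
    ringKrullDim (ExRing k d ⧸ varIdeal k (choiceSet c)) = d := by
  rw [(isTransversal_choiceSet c).ringKrullDim, card_compl_choiceSet]

/-- Since x_i y_i = 0, a prime contains a variable of each pair; c records the i with x_i in p, and
y_i lies in p for the others. -/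
lemma exists_choiceSet_le (p : Ideal (ExRing k d)) [p.IsPrime] :
    ∃ c, varIdeal k (choiceSet c) ≤ p := by
  refine ⟨{i | xbar k (xIdx i) ∈ p}, ?_⟩
  rw [varIdeal, Ideal.span_le]
  rintro _ ⟨j, hj | hj, rfl⟩
  · obtain ⟨i, hi, rfl⟩ := hj
    exact hi
  · obtain ⟨i, hi, rfl⟩ := hj
    have h1 : xbar k (xIdx i) * xbar k (yIdx i) ∈ p := by
      rw [xbar_mul]
      exact p.zero_mem
    exact (Ideal.IsPrime.mem_or_mem ‹_› h1).resolve_left hi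

lemma ringKrullDim_exRing : ringKrullDim (ExRing k d) = d := by
  apply le_antisymm
  · refine iSup_le fun l => ?_
    -- A chain of primes lies entirely above the ideal found below its smallest member, hence is a
    -- chain in a polynomial ring in d variables.
    obtain ⟨c, hc⟩ := exists_choiceSet_le l.head.asIdeal
    rw [← ringKrullDim_choiceSet (k := k) c, ringKrullDim_quotient]
    let l' : LTSeries (PrimeSpectrum.zeroLocus (varIdeal k (choiceSet c) : Set (ExRing k d))) :=
      { length := l.length
        toFun i := ⟨l i, hc.trans (LTSeries.head_le l i)⟩
        step i := l.step i }
    exact Order.LTSeries.length_le_krullDim l'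
  · rw [← ringKrullDim_choiceSet (k := k) (d := d) ∅]
    exact ringKrullDim_quotient_le _

lemma setOf_lt_eq_choiceSet : {j : Fin (2 * d) | j.val < d} = choiceSet Set.univ := by
  ext j
  rcases xIdx_or_yIdx j with ⟨i, rfl⟩ | ⟨i, rfl⟩
  · simp [xIdx_mem_choiceSet]
  · simp [yIdx_mem_choiceSet]

lemma setOf_le_eq_choiceSet : {j : Fin (2 * d) | d ≤ j.val} = choiceSet ∅ := by
  ext j
  rcases xIdx_or_yIdx j with ⟨i, rfl⟩ | ⟨i, rfl⟩
  · simp [xIdx_mem_choiceSet]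
  · simp [yIdx_mem_choiceSet]

lemma supportDim_modM {r : ℕ} (hr : r ≤ d) :
    Module.supportDim (ExRing k d) (ModM k d r) = d := by
  rw [Module.supportDim_quotient_eq_ringKrullDim]
  apply le_antisymm
  · exact (ringKrullDim_quotient_le _).trans ringKrullDim_exRing.le
  · rw [← ringKrullDim_choiceSet (k := k) (d := d) Set.univ]
    have h : idealM k d r ≤ varIdeal k (choiceSet Set.univ) := by
      rw [← setOf_lt_eq_choiceSet]
      exact varIdeal_mono fun j (hj : j.val < r) => hj.trans_le hr
    exact ringKrullDim_le_of_surjective (Ideal.Quotient.factor h)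
      (Ideal.Quotient.factor_surjective h)

lemma isTransversal_setOf_le {r : ℕ} (hr : r ≤ d) :
    IsTransversal {j : Fin (2 * d) | r ≤ j.val} := fun i => Or.inr (by
  simp only [Set.mem_ofPred_eq]
  omega)

lemma card_compl_setOf_le {r : ℕ} (hr : r ≤ d) :
    Nat.card {j : Fin (2 * d) // j ∉ {j : Fin (2 * d) | r ≤ j.val}} = r := by
  let e : {j : Fin (2 * d) // j ∉ {j : Fin (2 * d) | r ≤ j.val}} ≃ Fin r :=
    { toFun j := ⟨j.1, not_le.1 j.2⟩
      invFun i := ⟨⟨i, by omega⟩, not_le.2 i.2⟩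
      left_inv _ := rfl
      right_inv _ := rfl }
  rw [Nat.card_congr e, Nat.card_fin]

lemma supportDim_modN {r : ℕ} (hr : r ≤ d) :
    Module.supportDim (ExRing k d) (ModN k d r) = r := by
  rw [Module.supportDim_quotient_eq_ringKrullDim, idealN_eq_varIdeal,
    (isTransversal_setOf_le hr).ringKrullDim, card_compl_setOf_le hr]

lemma length_modN_zero : Module.length (ExRing k d) (ModN k d 0) = 1 := by
  have h := isTransversal_setOf_le (d := d) (Nat.zero_le d)
  have : IsEmpty {j : Fin (2 * d) // j ∉ {j : Fin (2 * d) | 0 ≤ j.val}} := ⟨fun j => j.2 (Nat.zero_le _)⟩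
  have hf : IsField (ModN k d 0) :=
    MulEquiv.isField (Field.toIsField k)
      ((h.equiv (k := k)).trans (isEmptyRingEquiv k _)).toMulEquiv
  rw [Module.length_eq_one_iff]
  have : (idealN k d 0).IsMaximal := Ideal.Quotient.maximal_of_isField _ hf
  exact isSimpleModule_iff_quot_maximal.2 ⟨_, this, ⟨LinearEquiv.refl _ _⟩⟩

end Transversal

/-! ### Failure of rank when r = d. -/

section Rank

variable {k : Type u} [Field k] {d : ℕ}

lemma xbar_ne_zero (j : Fin (2 * d)) : xbar k j ≠ 0 := by
  intro h
  have := (xbar_mem_varIdeal (k := k) (A := ∅) (j := j)).1 (by rw [h]; exact zero_mem _)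
  exact this

/-- A cyclic module whose annihilator contains a nonzero element `a` and is killed by a nonzero
element `b` has no rank. -/
lemma not_hasARank_quotient {R : Type u} [CommRing R] (I : Ideal R) {a b : R} (ha : a ∈ I)
    (ha0 : a ≠ 0) (hb : ∀ z ∈ I, b * z = 0) (hb0 : b ≠ 0) : ¬ HasARank R (R ⧸ I) := by
  rintro ⟨n, ⟨e⟩⟩
  have hinj : Function.Injective (algebraMap R (FractionRing R)) :=
    IsFractionRing.injective R (FractionRing R)
  have hkill : ∀ z : TensorProduct R (FractionRing R) (R ⧸ I), a • z = 0 := by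
    intro z
    induction z using TensorProduct.induction_on with
    | zero => exact smul_zero _
    | add z w hz hw => rw [smul_add, hz, hw, add_zero]
    | tmul z w =>
      obtain ⟨w, rfl⟩ := Ideal.Quotient.mk_surjective w
      have : a • Ideal.Quotient.mk I w = 0 :=
        Ideal.Quotient.eq_zero_iff_mem.2 (Ideal.mul_mem_right _ _ ha)
      rw [← TensorProduct.tmul_smul, this, TensorProduct.tmul_zero]
  rcases Nat.eq_zero_or_pos n with rfl | hn
  -- Rank zero is impossible: since b kills I, multiplication by b maps R/I to the total fraction
  -- ring and sends 1 to b ≠ 0, so the tensor product is nonzero.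
  · have h0 : (1 : FractionRing R) ⊗ₜ[R] (Ideal.Quotient.mk I 1) = 0 :=
      e.injective (Subsingleton.elim _ _)
    have hlin : ∀ z ∈ I, ∀ w : FractionRing R, (b * z) • w = 0 := fun z hz w => by
      rw [hb z hz, zero_smul]
    let f : TensorProduct R (FractionRing R) (R ⧸ I) →ₗ[R] FractionRing R :=
      TensorProduct.lift (LinearMap.flip (Submodule.liftQ I
        ((LinearMap.lsmul R (FractionRing R)).comp (LinearMap.lsmul R R b)) (by
          intro z hz
          ext w
          exact hlin z hz w)))
    have h1 : f ((1 : FractionRing R) ⊗ₜ[R] (Ideal.Quotient.mk I 1)) =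
        (b * 1) • (1 : FractionRing R) := rfl
    rw [h0, map_zero, mul_one, Algebra.smul_def, mul_one] at h1
    exact hb0 (hinj (by rw [← h1, map_zero]))
  -- Positive rank is impossible: a kills the tensor product, but not the vector of ones.
  · have h1 : a • (fun _ => 1 : Fin n → FractionRing R) = 0 := by
      obtain ⟨z, hz⟩ := e.surjective (fun _ => 1)
      rw [← hz, ← algebraMap_smul (FractionRing R) a, ← map_smul, algebraMap_smul, hkill, map_zero]
    have h2 := congrFun h1 ⟨0, hn⟩
    simp only [Pi.smul_apply, Pi.zero_apply, Algebra.smul_def, mul_one] at h2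
    exact ha0 (hinj (by rw [h2, map_zero]))

lemma xbar_mul_prod_yIdx (i : Fin d) : (∏ l, xbar k (yIdx l)) * xbar k (xIdx i) = 0 := by
  obtain ⟨z, hz⟩ := Finset.dvd_prod_of_mem (fun l => xbar k (yIdx l)) (Finset.mem_univ i)
  rw [hz, mul_comm, ← mul_assoc, xbar_mul, zero_mul]

lemma xbar_mul_prod_xIdx (i : Fin d) : (∏ l, xbar k (xIdx l)) * xbar k (yIdx i) = 0 := by
  obtain ⟨z, hz⟩ := Finset.dvd_prod_of_mem (fun l => xbar k (xIdx l)) (Finset.mem_univ i)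
  rw [hz, mul_right_comm, xbar_mul, zero_mul]

lemma mul_eq_zero_of_mem_varIdeal {A : Set (Fin (2 * d))} {b : ExRing k d}
    (h : ∀ j ∈ A, b * xbar k j = 0) : ∀ z ∈ varIdeal k A, b * z = 0 := by
  intro z hz
  induction hz using Submodule.span_induction with
  | mem z hz =>
    obtain ⟨j, hj, rfl⟩ := hz
    exact h j hj
  | zero => exact mul_zero b
  | add z w _ _ hz hw => rw [mul_add, hz, hw, add_zero]
  | smul c z _ hz => rw [smul_eq_mul, mul_left_comm, hz, mul_zero]

/-- The product survives modulo the prime generated by A, as none of its factors lies there. -/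
lemma prod_ne_zero_of_notMem {A : Set (Fin (2 * d))} (hA : IsTransversal A)
    {f : Fin d → Fin (2 * d)} (hf : ∀ i, f i ∉ A) : ∏ i, xbar k (f i) ≠ 0 := by
  intro h
  have := hA.isPrime (k := k)
  have h1 : ∏ i, xbar k (f i) ∈ varIdeal k A := by
    rw [h]
    exact zero_mem _
  obtain ⟨i, -, hi⟩ := (Ideal.IsPrime.prod_mem_iff).1 h1
  exact hf i (xbar_mem_varIdeal.1 hi)

lemma not_hasARank_modM (hd : 0 < d) : ¬ HasARank (ExRing k d) (ModM k d d) := by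
  refine not_hasARank_quotient (varIdeal k {j | j.val < d}) (a := xbar k (xIdx ⟨0, hd⟩))
    (b := ∏ l, xbar k (yIdx l)) (xbar_mem_varIdeal.2 hd) (xbar_ne_zero _)
    (mul_eq_zero_of_mem_varIdeal ?_) (prod_ne_zero_of_notMem (isTransversal_choiceSet Set.univ)
      fun i => ?_)
  · exact fun j (hj : j.val < d) => xbar_mul_prod_yIdx ⟨j, hj⟩
  · simp [yIdx_mem_choiceSet]

lemma not_hasARank_modN (hd : 0 < d) : ¬ HasARank (ExRing k d) (ModN k d d) := by
  refine not_hasARank_quotient (varIdeal k {j | d ≤ j.val}) (a := xbar k (yIdx ⟨0, hd⟩))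
    (b := ∏ l, xbar k (xIdx l)) (xbar_mem_varIdeal.2 (Nat.le_add_right d 0)) (xbar_ne_zero _)
    (mul_eq_zero_of_mem_varIdeal ?_) (prod_ne_zero_of_notMem (isTransversal_choiceSet ∅)
      fun i => ?_)
  · intro j hj
    rw [setOf_le_eq_choiceSet] at hj
    rcases xIdx_or_yIdx j with ⟨i, rfl⟩ | ⟨i, rfl⟩
    · exact absurd hj (by simp [xIdx_mem_choiceSet])
    · exact xbar_mul_prod_xIdx i
  · simp [xIdx_mem_choiceSet]

end Rank

/-! ### Compositions into odd parts and the lengths of Ext. -/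

section Counting

/-- The length of `Ext^n(M_j, N_j)`: the number of ways of writing `n` as an ordered sum of `j`
odd positive integers. -/
def oddCompositions : ℕ → ℕ → ℕ
  | 0, 0 => 1
  | 0, _ + 1 => 0
  | _ + 1, 0 => 0
  | j + 1, 1 => oddCompositions j 0
  -- A chosen part is either at least 3, and is lowered by two, or equal to 1, and is removed.
  | j + 1, n + 2 => oddCompositions (j + 1) n + oddCompositions j (n + 1)

lemma oddCompositions_of_lt {j n : ℕ} (h : n < j) : oddCompositions j n = 0 := by
  induction j, n using oddCompositions.induct with
  | case1 => omega
  | case2 => omega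
  | case3 => rw [oddCompositions]
  | case4 j ih =>
    rw [oddCompositions]
    exact ih (Nat.lt_of_succ_lt_succ h)
  | case5 j n ih1 ih2 => rw [oddCompositions, ih1 (by omega), ih2 (by omega)]

lemma oddCompositions_odd (j m : ℕ) : oddCompositions j (j + 2 * m + 1) = 0 := by
  induction j generalizing m with
  | zero => rw [oddCompositions]
  | succ j ih =>
    induction m with
    | zero =>
      rw [show j + 1 + 2 * 0 + 1 = j + 2 by ring, oddCompositions, oddCompositions_of_lt (by omega)]
      simpa using ih 0
    | succ m ihm =>
      rw [show j + 1 + 2 * (m + 1) + 1 = (j + 1 + 2 * m + 1) + 2 by ring, oddCompositions, ihm,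
        show j + 1 + 2 * m + 1 + 1 = j + 2 * (m + 1) + 1 by ring, ih]

/-- Writing each odd part as 1 + 2a turns this into counting ways of writing m as an ordered sum of
j + 1 nonnegative integers; the induction is Pascal's rule. -/
lemma oddCompositions_even (j m : ℕ) :
    oddCompositions (j + 1) (j + 1 + 2 * m) = (m + j).choose j := by
  induction j generalizing m with
  | zero =>
    induction m with
    | zero => simp [oddCompositions]
    | succ m ihm =>
      rw [show 0 + 1 + 2 * (m + 1) = (0 + 1 + 2 * m) + 2 by ring, oddCompositions, ihm,
        show 0 + 1 + 2 * m + 1 = (2 * m + 1) + 1 by ring, oddCompositions]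
      simp
  | succ j ih =>
    induction m with
    | zero =>
      rw [show j + 1 + 1 + 2 * 0 = j + 2 by ring, oddCompositions,
        oddCompositions_of_lt (by omega)]
      simpa using ih 0
    | succ m ihm =>
      rw [show j + 1 + 1 + 2 * (m + 1) = (j + 1 + 1 + 2 * m) + 2 by ring, oddCompositions, ihm,
        show j + 1 + 1 + 2 * m + 1 = j + 1 + 2 * (m + 1) by ring, ih,
        show m + 1 + (j + 1) = (m + (j + 1)) + 1 by ring, Nat.choose_succ_succ,
        show m + 1 + j = m + (j + 1) by ring, add_comm]

variable {k : Type u} [Field k] {d : ℕ}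

theorem extLength_modM_modN {j : ℕ} (hj : j ≤ d) (n : ℕ) :
    extLength (ExRing k d) (ModM k d j) (ModN k d j) n = oddCompositions j n := by
  induction j generalizing n with
  | zero =>
    have h0 : idealM k d 0 = ⊥ := by
      rw [idealM_eq_varIdeal, ← varIdeal_empty]
      congr 1
      ext
      simp
    rw [extLength_congr_left (Submodule.quotEquivOfEqBot _ h0)]
    cases n with
    | zero => rw [extLength_zero_of_self, length_modN_zero, oddCompositions, Nat.cast_one]
    | succ n => rw [extLength_succ_of_self, oddCompositions, Nat.cast_zero]
  | succ j ih =>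
    have hj' : j < d := hj
    have hsum : ∀ n, extLength (ExRing k d) (ModM k d (j + 1)) (ModN k d (j + 1)) n +
        extLength (ExRing k d) (ModM k d (j + 1)) (ModN k d (j + 1)) (n + 1) =
        ((∑ i ∈ Finset.range (n + 1), oddCompositions j i : ℕ) : ℕ∞) := by
      intro n
      rw [← extLength_modN_add hj', extLength_modM_succ_modN hj', Nat.cast_sum]
      exact Finset.sum_congr rfl fun i _ => ih hj'.le i
    have hzero := extLength_modM_succ_zero (k := k) hj'
    induction n using Nat.twoStepInduction with
    | zero => rw [hzero, oddCompositions, Nat.cast_zero]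
    | one =>
      have h := hsum 0
      rw [hzero, zero_add] at h
      simpa [oddCompositions] using h
    | more n ih1 ih2 =>
      -- Subtracting consecutive instances of `hsum` gives e_{j+1}(n+2) = e_{j+1}(n) + e_j(n+1), the
      -- recursion of `oddCompositions`. Cancelling e_{j+1}(n+1) in `ℕ∞` is legitimate because it is
      -- finite by induction.
      have h := hsum (n + 1)
      rw [Finset.sum_range_succ, Nat.cast_add, ← hsum n, add_comm (extLength _ _ _ n), add_assoc, ih1,
        ih2] at h
      have h1 := ENat.add_right_injective_of_ne_top
        (ENat.natCast_ne_top _) (h.trans (add_assoc _ _ _))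
      rw [h1, oddCompositions, Nat.cast_add]

lemma beta_modM_modN {j : ℕ} (hj : j ≤ d) (n : ℕ) :
    beta (ExRing k d) (ModM k d j) (ModN k d j) n = oddCompositions j n := by
  rw [beta, extLength_modM_modN hj, ENat.toNat_natCast]

lemma fext_modM_modN {j : ℕ} (hj : j ≤ d) :
    fext (ExRing k d) (ModM k d j) (ModN k d j) < ⊤ := by
  refine lt_of_le_of_lt (sInf_le ⟨0, fun i _ => ?_, rfl⟩) (EReal.coe_lt_top _)
  rw [extLength_modM_modN hj]
  exact ENat.natCast_ne_top _

end Counting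

/-! ### Hilbert polynomials, complexity and the invariant h. -/

section HilbertPolynomial

open Polynomial

/-- The polynomial with value `C(m + q, q)` at `q + 1 + 2m`. -/
def oddCompositionsPoly (q : ℕ) : ℚ[X] :=
  -- C(m+q, q) is the rising factorial (m+1)⋯(m+q) over q!, and the inner linear polynomial takes
  -- the value m + 1 at t = q + 1 + 2m.
  C ((q.factorial : ℚ)⁻¹) * (ascPochhammer ℚ q).comp (C (1 / 2) * X + C (1 - (q + 1) / 2 : ℚ))

lemma eval_oddCompositionsPoly (q m : ℕ) :
    (oddCompositionsPoly q).eval ((q + 1 + 2 * m : ℕ) : ℚ) = oddCompositions (q + 1) (q + 1 + 2 * m) := by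
  have h1 : (1 / 2 * ((q + 1 + 2 * m : ℕ) : ℚ) + (1 - (q + 1) / 2)) = ((m + 1 : ℕ) : ℚ) := by
    push_cast
    ring
  rw [oddCompositionsPoly, eval_mul, eval_C, eval_comp, eval_add, eval_mul, eval_C, eval_X, eval_C,
    h1, ← ascPochhammer_eval_cast, ascPochhammer_nat_eq_ascFactorial,
    Nat.ascFactorial_eq_factorial_mul_choose, oddCompositions_even, Nat.cast_mul,
    inv_mul_cancel_left₀ (Nat.cast_ne_zero.2 q.factorial_ne_zero)]

lemma coeff_oddCompositionsPoly_ne_zero (q : ℕ) : (oddCompositionsPoly q).coeff q ≠ 0 := by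
  have hlin : (C (1 / 2) * X + C (1 - (q + 1) / 2 : ℚ)).natDegree = 1 :=
    natDegree_linear (by norm_num)
  have hdeg : ((ascPochhammer ℚ q).comp (C (1 / 2) * X + C (1 - (q + 1) / 2 : ℚ))).natDegree = q := by
    rw [natDegree_comp, hlin, ascPochhammer_natDegree, mul_one]
  rw [oddCompositionsPoly, coeff_C_mul]
  refine mul_ne_zero (inv_ne_zero (Nat.cast_ne_zero.2 q.factorial_ne_zero)) ?_
  have h2 : (ascPochhammer ℚ q).comp (C (1 / 2) * X + C (1 - (q + 1) / 2 : ℚ)) ≠ 0 := by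
    intro h0
    rcases comp_eq_zero_iff.1 h0 with h | ⟨-, h⟩
    · exact (monic_ascPochhammer ℚ q).ne_zero h
    · rw [h, natDegree_C] at hlin
      exact zero_ne_one hlin
  have h3 := leadingCoeff_ne_zero.2 h2
  rwa [leadingCoeff, hdeg] at h3

section

variable (R : Type u) [CommRing R] (M N : Type u) [AddCommGroup M] [Module R M]
  [AddCommGroup N] [Module R N]

lemma polynomial_eq_of_eventually {P Q : ℚ[X]} {f : ℕ → ℕ} (hf : StrictMono f)
    (h : ∀ᶠ i in Filter.atTop, P.eval ((f i : ℕ) : ℚ) = Q.eval ((f i : ℕ) : ℚ)) : P = Q := by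
  obtain ⟨n, hn⟩ := Filter.eventually_atTop.1 h
  refine eq_of_infinite_eval_eq P Q (Set.Infinite.mono
    (s := (fun i : ℕ => ((f i : ℕ) : ℚ)) '' Set.Ici n) ?_ ?_)
  · rintro _ ⟨i, hi, rfl⟩
    exact hn i hi
  · exact (Set.Ici_infinite n).image fun i _ j _ hij => hf.injective (Nat.cast_injective hij)

variable {R M N}

/-- Agreement at infinitely many points determines a polynomial, so the choice in the definition is
immaterial. -/
lemma evenHilbertPolynomial_eq {P : ℚ[X]} (h : IsEvenHilbertPolynomial R M N P) :
    evenHilbertPolynomial R M N = P := by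
  have hex : ∃ P, IsEvenHilbertPolynomial R M N P := ⟨P, h⟩
  rw [evenHilbertPolynomial, dif_pos hex]
  refine polynomial_eq_of_eventually (f := fun i => 2 * i) (fun i j hij => by simpa using hij) ?_
  filter_upwards [h, hex.choose_spec] with i h1 h2
  exact h2.trans h1.symm

lemma oddHilbertPolynomial_eq {P : ℚ[X]} (h : IsOddHilbertPolynomial R M N P) :
    oddHilbertPolynomial R M N = P := by
  have hex : ∃ P, IsOddHilbertPolynomial R M N P := ⟨P, h⟩
  rw [oddHilbertPolynomial, dif_pos hex]
  refine polynomial_eq_of_eventually (f := fun i => 2 * i + 1) (fun i j hij => by simpa using hij) ?_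
  filter_upwards [h, hex.choose_spec] with i h1 h2
  exact h2.trans h1.symm

end

variable {k : Type u} [Field k] {d : ℕ}

lemma isHilbertPolynomial_of_even {q : ℕ} (hq : q + 1 ≤ d) (h : Even (q + 1)) :
    IsEvenHilbertPolynomial (ExRing k d) (ModM k d (q + 1)) (ModN k d (q + 1))
      (oddCompositionsPoly q) ∧
    IsOddHilbertPolynomial (ExRing k d) (ModM k d (q + 1)) (ModN k d (q + 1)) 0 := by
  obtain ⟨c, hc⟩ := h
  constructor
  · filter_upwards [Filter.eventually_ge_atTop c] with i hi
    rw [beta_modM_modN hq, show 2 * i = q + 1 + 2 * (i - c) by omega, eval_oddCompositionsPoly]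
  · filter_upwards [Filter.eventually_ge_atTop c] with i hi
    rw [beta_modM_modN hq, show 2 * i + 1 = q + 1 + 2 * (i - c) + 1 by omega, oddCompositions_odd,
      eval_zero, Nat.cast_zero]

lemma isHilbertPolynomial_of_odd {q : ℕ} (hq : q + 1 ≤ d) (h : Odd (q + 1)) :
    IsEvenHilbertPolynomial (ExRing k d) (ModM k d (q + 1)) (ModN k d (q + 1)) 0 ∧
    IsOddHilbertPolynomial (ExRing k d) (ModM k d (q + 1)) (ModN k d (q + 1))
      (oddCompositionsPoly q) := by
  obtain ⟨c, hc⟩ := h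
  constructor
  -- Here q + 1 = 2c + 1, so the even number 2i has the parity opposite to q + 1 and exceeds it only
  -- from i = c + 1 on.
  · filter_upwards [Filter.eventually_ge_atTop (c + 1)] with i hi
    rw [beta_modM_modN hq, show 2 * i = q + 1 + 2 * (i - c - 1) + 1 by omega, oddCompositions_odd,
      eval_zero, Nat.cast_zero]
  · filter_upwards [Filter.eventually_ge_atTop c] with i hi
    rw [beta_modM_modN hq, show 2 * i + 1 = q + 1 + 2 * (i - c) by omega, eval_oddCompositionsPoly]

lemma oddCompositions_le_pow (q n : ℕ) : oddCompositions (q + 1) n ≤ n ^ q := by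
  rcases lt_or_ge n (q + 1) with h | h
  · rw [oddCompositions_of_lt h]
    exact Nat.zero_le _
  · obtain ⟨t, rfl⟩ := Nat.exists_eq_add_of_le h
    obtain ⟨m, rfl | rfl⟩ := Nat.even_or_odd' t
    · rw [oddCompositions_even]
      exact (Nat.choose_le_pow _ _).trans (Nat.pow_le_pow_left (by omega) _)
    · rw [← add_assoc, oddCompositions_odd]
      exact Nat.zero_le _

lemma pow_le_oddCompositions (q m : ℕ) :
    (m + 1) ^ q ≤ q.factorial * oddCompositions (q + 1) (q + 1 + 2 * m) := by
  rw [oddCompositions_even, ← Nat.ascFactorial_eq_factorial_mul_choose]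
  exact Nat.pow_succ_le_ascFactorial (m + 1) q

/-- Along n = q + 1 + 2m the count is at least (m+1)^q / q!, of order n^q, while b - 1 ≤ q - 1. The
exponent is an integer because b = 0 gives -1. -/
lemma not_bounded_oddCompositions {q b : ℕ} (hb : b < q + 1) (a : ℝ) :
    ¬ ∀ᶠ n : ℕ in Filter.atTop,
      (oddCompositions (q + 1) n : ℝ) ≤ a * (n : ℝ) ^ ((b : ℤ) - 1) := by
  intro h
  obtain ⟨n₀, hn₀⟩ := Filter.eventually_atTop.1 h
  -- The factor q + 3 comes from q + 1 + 2m ≤ (q + 3)(m + 1); the supposed bound then forces m + 1 ≤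
  -- K for all large m.
  set K : ℝ := q.factorial * |a| * ((q + 3 : ℕ) : ℝ) ^ q with hK
  suffices h : ∀ m ≥ n₀, ((m + 1 : ℕ) : ℝ) ≤ K by
    obtain ⟨m, hm⟩ := exists_nat_gt K
    have := h (max m n₀) (le_max_right _ _)
    have h2 : (m : ℝ) ≤ ((max m n₀ + 1 : ℕ) : ℝ) := by
      exact_mod_cast (le_max_left m n₀).trans (Nat.le_succ _)
    linarith
  intro m hm
  have hpos : (0 : ℝ) < ((m + 1 : ℕ) : ℝ) := by positivity
  have hfac : (0 : ℝ) < q.factorial := by exact_mod_cast q.factorial_pos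
  have h1 := hn₀ (q + 1 + 2 * m) (by omega)
  have h2 : (((m + 1) ^ q : ℕ) : ℝ) ≤ q.factorial * oddCompositions (q + 1) (q + 1 + 2 * m) := by
    exact_mod_cast pow_le_oddCompositions q m
  have hn1 : (1 : ℝ) ≤ ((q + 1 + 2 * m : ℕ) : ℝ) := by
    exact_mod_cast (by omega : 1 ≤ q + 1 + 2 * m)
  have hn2 : ((m + 1 : ℕ) : ℝ) ≤ ((q + 1 + 2 * m : ℕ) : ℝ) := by
    exact_mod_cast (by omega : m + 1 ≤ q + 1 + 2 * m)
  have hn3 : ((q + 1 + 2 * m : ℕ) : ℝ) ≤ ((q + 3 : ℕ) : ℝ) * ((m + 1 : ℕ) : ℝ) := by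
    exact_mod_cast (by nlinarith : q + 1 + 2 * m ≤ (q + 3) * (m + 1))
  have h3 : a * ((q + 1 + 2 * m : ℕ) : ℝ) ^ ((b : ℤ) - 1) ≤
      |a| * ((((q + 3 : ℕ) : ℝ) * ((m + 1 : ℕ) : ℝ)) ^ q / ((m + 1 : ℕ) : ℝ)) := by
    refine mul_le_mul (le_abs_self a) ?_ (by positivity) (abs_nonneg a)
    refine (zpow_le_zpow_right₀ hn1 (by omega : (b : ℤ) - 1 ≤ (q : ℤ) - 1)).trans ?_
    rw [zpow_sub_one₀ (by positivity), zpow_natCast, ← div_eq_mul_inv]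
    gcongr
  have h4 : ((m + 1 : ℕ) : ℝ) ^ q ≤ K * ((m + 1 : ℕ) : ℝ) ^ q / ((m + 1 : ℕ) : ℝ) := by
    calc ((m + 1 : ℕ) : ℝ) ^ q ≤ q.factorial * oddCompositions (q + 1) (q + 1 + 2 * m) := by
          exact_mod_cast h2
      _ ≤ q.factorial * (|a| * ((((q + 3 : ℕ) : ℝ) * ((m + 1 : ℕ) : ℝ)) ^ q /
          ((m + 1 : ℕ) : ℝ))) := mul_le_mul_of_nonneg_left (h1.trans h3) hfac.le
      _ = _ := by rw [hK, mul_pow]; ring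
  rw [le_div_iff₀ hpos, mul_comm] at h4
  exact le_of_mul_le_mul_right h4 (pow_pos hpos q)

theorem cx_modM_modN {q : ℕ} (hq : q + 1 ≤ d) :
    cx (ExRing k d) (ModM k d (q + 1)) (ModN k d (q + 1)) = ((q + 1 : ℕ) : ℕ∞) := by
  apply le_antisymm
  · refine sInf_le ⟨q + 1, ⟨1, Filter.Eventually.of_forall fun n => ?_⟩, rfl⟩
    rw [beta_modM_modN hq, one_mul, Nat.cast_add, Nat.cast_one, add_sub_cancel_right, zpow_natCast]
    exact_mod_cast oddCompositions_le_pow q n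
  · refine le_sInf ?_
    rintro _ ⟨b, ⟨a, ha⟩, rfl⟩
    by_contra! hb
    refine not_bounded_oddCompositions (q := q) (b := b) (by exact_mod_cast hb) a ?_
    simpa only [beta_modM_modN hq] using ha

theorem hInvariant_modM_modN {q : ℕ} (hq : q + 1 ≤ d) :
    hInvariant (ExRing k d) (ModM k d (q + 1)) (ModN k d (q + 1)) ≠ 0 := by
  rw [hInvariant, cx_modM_modN hq, if_neg (by exact_mod_cast q.succ_ne_zero), ENat.toNat_natCast,
    Nat.add_sub_cancel]
  rcases Nat.even_or_odd (q + 1) with h | h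
  · rw [evenHilbertPolynomial_eq (isHilbertPolynomial_of_even hq h).1,
      oddHilbertPolynomial_eq (isHilbertPolynomial_of_even hq h).2, coeff_zero, sub_zero]
    exact coeff_oddCompositionsPoly_ne_zero q
  · rw [evenHilbertPolynomial_eq (isHilbertPolynomial_of_odd hq h).1,
      oddHilbertPolynomial_eq (isHilbertPolynomial_of_odd hq h).2, coeff_zero, zero_sub]
    exact neg_ne_zero.2 (coeff_oddCompositionsPoly_ne_zero q)

end HilbertPolynomial

/-! ### The relations form a homogeneous regular sequence. -/

section CompleteIntersection

open MvPolynomial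

variable {k : Type u} [Field k] {d : ℕ} (w : Fin (2 * d) → ℕ)

lemma isHomogeneousIdeal_varIdeal (A : Set (Fin (2 * d))) :
    IsHomogeneousIdeal w (relIdeal k d) (varIdeal k A) := by
  refine ⟨X '' A, ?_, ?_⟩
  · rintro _ ⟨j, -, rfl⟩
    exact ⟨w j, isWeightedHomogeneous_X k w j⟩
  · rw [varIdeal_eq_map, Ideal.map_span]

/-- Different relations involve disjoint pairs of variables, so the factor x_i y_i contributes
nothing to divisibility by an earlier relation. -/
lemma mul_mem_monoIdeal_iff {i : Fin d} {f : MvPolynomial (Fin (2 * d)) k}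
    (h : X (xIdx i) * X (yIdx i) * f ∈ monoIdeal k ∅ {j | j < i}) :
    f ∈ monoIdeal k ∅ {j | j < i} := by
  rw [mul_assoc, X_mul_mem_monoIdeal] at h
  rw [mem_monoIdeal]
  intro m hm
  have hm' : Finsupp.single (yIdx i) 1 + m ∈ (X (yIdx i) * f).support := by
    rw [support_X_mul]
    exact Finset.mem_map.2 ⟨m, hm, rfl⟩
  rcases h _ hm' with ⟨l, hl, -⟩ | ⟨l, hl, h1, h2⟩
  · exact absurd hl (Set.notMem_empty l)
  · have hli : l ≠ i := ne_of_lt hl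
    have h3 : xIdx l ≠ xIdx i := fun h => hli (xIdx_injective h)
    have h4 : yIdx l ≠ yIdx i := fun h => hli (yIdx_injective h)
    have h5 := h1.resolve_right h3
    have h6 := h2.resolve_right (xIdx_ne_yIdx i l).symm
    rw [Finsupp.add_apply, Finsupp.single_eq_of_ne (xIdx_ne_yIdx l i), zero_add] at h5
    rw [Finsupp.add_apply, Finsupp.single_eq_of_ne h4, zero_add] at h6
    exact Or.inr ⟨l, hl, h5, h6⟩

lemma isRegular_rel : RingTheory.Sequence.IsRegular (MvPolynomial (Fin (2 * d)) k)
    (List.ofFn fun i : Fin d => (X (xIdx i) * X (yIdx i) : MvPolynomial (Fin (2 * d)) k)) := by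
  refine ⟨⟨fun i hi => ?_⟩, ?_⟩
  · have hid : i < d := by simpa using hi
    have h1 : (Ideal.ofList ((List.ofFn fun i : Fin d =>
        (X (xIdx i) * X (yIdx i) : MvPolynomial (Fin (2 * d)) k)).take i) •
        (⊤ : Submodule (MvPolynomial (Fin (2 * d)) k) (MvPolynomial (Fin (2 * d)) k))) =
        monoIdeal k ∅ {j | j < ⟨i, hid⟩} := by
      rw [smul_eq_mul, Ideal.mul_top, Ideal.ofList, monoIdeal]
      congr 1
      ext f
      simp only [List.mem_take_iff_getElem, List.length_ofFn, List.getElem_ofFn, Set.image_empty,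
        Set.empty_union, Set.mem_image, Set.mem_ofPred_eq]
      constructor
      · rintro ⟨j, hj, rfl⟩
        exact ⟨⟨j, by omega⟩, (by simp only [Fin.mk_lt_mk]; omega), rfl⟩
      · rintro ⟨j, hj, rfl⟩
        have hj : j.val < i := hj
        exact ⟨j, by omega, rfl⟩
    rw [isSMulRegular_iff_right_eq_zero_of_smul]
    intro z hz
    obtain ⟨f, rfl⟩ := Submodule.Quotient.mk_surjective _ z
    rw [← Submodule.Quotient.mk_smul, Submodule.Quotient.mk_eq_zero, h1, List.getElem_ofFn] at hz
    rw [Submodule.Quotient.mk_eq_zero, h1]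
    exact mul_mem_monoIdeal_iff hz
  · intro h
    have h1 : (1 : MvPolynomial (Fin (2 * d)) k) ∈ monoIdeal k (∅ : Set (Fin (2 * d))) Set.univ := by
      have h2 : (1 : MvPolynomial (Fin (2 * d)) k) ∈
          (⊤ : Submodule (MvPolynomial (Fin (2 * d)) k) (MvPolynomial (Fin (2 * d)) k)) := trivial
      rw [h, smul_eq_mul, Ideal.mul_top, Ideal.ofList] at h2
      have h3 : relIdeal k d = Ideal.span {f | f ∈ List.ofFn fun i : Fin d =>
          (X (xIdx i) * X (yIdx i) : MvPolynomial (Fin (2 * d)) k)} := by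
        rw [relIdeal]
        congr 1
        ext f
        exact List.mem_ofFn.symm
      rw [← relIdeal_eq_monoIdeal, h3]
      exact h2
    rw [mem_monoIdeal] at h1
    have h3 := h1 0 (by simp)
    simp at h3

theorem isGradedCompleteIntersection_relIdeal (hw : ∀ j, 0 < w j) :
    IsGradedCompleteIntersection w (relIdeal k d) d := by
  refine ⟨hw, ?_, fun i => X (xIdx i) * X (yIdx i), fun i => ?_, isRegular_rel, rfl⟩
  · rw [relIdeal, Ideal.span_le, pow_two]
    rintro _ ⟨i, rfl⟩
    exact Ideal.mul_mem_mul (Ideal.subset_span ⟨_, rfl⟩) (Ideal.subset_span ⟨_, rfl⟩)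
  · exact ⟨_, (isWeightedHomogeneous_X k w _).mul (isWeightedHomogeneous_X k w _)⟩

end CompleteIntersection

/-! ### Regularity in codimension zero and its failure in codimension one. -/

section Regularity

variable {k : Type u} [Field k] {d : ℕ} (w : Fin (2 * d) → ℕ)

lemma ringKrullDim_quotient_succ_le {R : Type u} [CommRing R] {Q p : Ideal R} [Q.IsPrime]
    (h : Q < p) : ringKrullDim (R ⧸ p) + 1 ≤ ringKrullDim (R ⧸ Q) := by
  obtain ⟨z, hz, hzQ⟩ := SetLike.exists_of_lt h
  have h0 : Ideal.Quotient.mk Q z ≠ 0 := fun h0 => hzQ (Ideal.Quotient.eq_zero_iff_mem.1 h0)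
  exact ringKrullDim_succ_le_of_surjective (Ideal.Quotient.factor h.le)
    (Ideal.Quotient.factor_surjective h.le) (mem_nonZeroDivisors_of_ne_zero h0)
    ((Ideal.Quotient.factor_mk h.le z).trans (Ideal.Quotient.eq_zero_iff_mem.2 hz))

/-- A prime strictly above the prime of a transversal contains a nonzero element of the quotient
domain, so its coheight drops below d. -/
lemma eq_choiceSet_of_ringKrullDim_le (p : Ideal (ExRing k d)) [p.IsPrime]
    (h : (d : WithBot ℕ∞) ≤ ringKrullDim (ExRing k d ⧸ p)) : ∃ c, p = varIdeal k (choiceSet c) := by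
  obtain ⟨c, hc⟩ := exists_choiceSet_le p
  refine ⟨c, ?_⟩
  by_contra hne
  have := (isTransversal_choiceSet c).isPrime (k := k)
  have h1 := ringKrullDim_quotient_succ_le (lt_of_le_of_ne hc (Ne.symm hne))
  rw [ringKrullDim_choiceSet] at h1
  have h2 : (d : WithBot ℕ∞) + 1 ≤ d := (add_le_add_left h 1).trans h1
  have h3 : d + 1 ≤ d := by exact_mod_cast h2
  omega

/-- Each variable generating p is annihilated by its partner, which lies outside p and becomes a
unit. So p localizes to zero and the local ring has zero maximal ideal. -/
theorem isRegularInCodim_zero : IsRegularInCodim w (relIdeal k d) 0 := by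
  intro p hp _ hdim
  obtain ⟨c, hc⟩ := eq_choiceSet_of_ringKrullDim_le p (by
    rw [← ringKrullDim_exRing (k := k)]
    simpa using hdim)
  have h1 : p.map (algebraMap (ExRing k d) (Localization.AtPrime p)) = ⊥ := by
    rw [eq_bot_iff, Ideal.map_le_iff_le_comap]
    refine hc.le.trans ?_
    rw [varIdeal, Ideal.span_le]
    have key : ∀ a b : ExRing k d, a * b = 0 → b ∉ p →
        algebraMap (ExRing k d) (Localization.AtPrime p) a = 0 := fun a b hab hb =>
      (IsLocalization.map_eq_zero_iff p.primeCompl _ a).2 ⟨⟨b, hb⟩, (mul_comm b a).trans hab⟩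
    rintro _ ⟨j, hj, rfl⟩
    rcases xIdx_or_yIdx j with ⟨i, rfl⟩ | ⟨i, rfl⟩
    · refine key _ _ (xbar_mul i) ?_
      rw [hc, xbar_mem_varIdeal, yIdx_mem_choiceSet, not_not]
      exact xIdx_mem_choiceSet.1 hj
    · refine key _ _ ((mul_comm _ _).trans (xbar_mul i)) ?_
      rw [hc, xbar_mem_varIdeal, xIdx_mem_choiceSet]
      exact yIdx_mem_choiceSet.1 hj
  apply IsRegularLocalRing.of_spanFinrank_maximalIdeal_le
  rw [← Localization.AtPrime.map_eq_maximalIdeal, h1, Submodule.spanFinrank_bot]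
  exact ringKrullDim_nonneg_of_nontrivial

/-- A unique minimal prime would lie both in (y_1, …, y_d) and in (x_1, …, x_d), yet it contains x_1
or y_1. -/
theorem not_existsUnique_minimalPrimes (hd : 0 < d) :
    ¬ ∃! p : Ideal (ExRing k d), p ∈ minimalPrimes (ExRing k d) := by
  rintro ⟨p, hp, huniq⟩
  have key : ∀ c : Set (Fin d), p ≤ varIdeal k (choiceSet c) := by
    intro c
    have := (isTransversal_choiceSet c).isPrime (k := k)
    obtain ⟨q, hq, hqle⟩ := Ideal.exists_minimalPrimes_le (bot_le (a := varIdeal k (choiceSet c)))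
    rw [← huniq q hq]
    exact hqle
  have hprime : p.IsPrime := hp.1.1
  have h0 : xbar k (xIdx ⟨0, hd⟩) * xbar k (yIdx ⟨0, hd⟩) ∈ p := by
    rw [xbar_mul]
    exact p.zero_mem
  rcases hprime.mem_or_mem h0 with h | h
  · have := xIdx_mem_choiceSet.1 (xbar_mem_varIdeal.1 (key ∅ h))
    exact this
  · exact yIdx_mem_choiceSet.1 (xbar_mem_varIdeal.1 (key Set.univ h)) trivial

/-- The variables `x_1, …, x_d` and `x_{d+1}`. -/
def nodeSet (hd : 0 < d) : Set (Fin (2 * d)) := insert (yIdx ⟨0, hd⟩) (choiceSet Set.univ)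

lemma isTransversal_nodeSet (hd : 0 < d) : IsTransversal (nodeSet hd) := fun _ =>
  Or.inl (Set.mem_insert_of_mem _ (xIdx_mem_choiceSet.2 trivial))

lemma xIdx_mem_nodeSet (hd : 0 < d) (i : Fin d) : xIdx i ∈ nodeSet hd :=
  Set.mem_insert_of_mem _ (xIdx_mem_choiceSet.2 trivial)

lemma yIdx_mem_nodeSet (hd : 0 < d) {i : Fin d} : yIdx i ∈ nodeSet hd ↔ i = ⟨0, hd⟩ := by
  rw [nodeSet, Set.mem_insert_iff, yIdx_injective.eq_iff, yIdx_mem_choiceSet]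
  simp

lemma card_compl_nodeSet (hd : 0 < d) : Nat.card {j // j ∉ nodeSet hd} + 1 = d := by
  have h1 : (insert (yIdx ⟨0, hd⟩) (nodeSet hd)ᶜ : Set (Fin (2 * d))) = (choiceSet Set.univ)ᶜ := by
    ext j
    rcases xIdx_or_yIdx j with ⟨i, rfl⟩ | ⟨i, rfl⟩
    · simp only [Set.mem_insert_iff, xIdx_ne_yIdx, Set.mem_compl_iff, xIdx_mem_nodeSet,
        xIdx_mem_choiceSet, Set.mem_univ, not_true, or_false]
    · simp only [Set.mem_insert_iff, yIdx_injective.eq_iff, Set.mem_compl_iff, yIdx_mem_nodeSet,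
        yIdx_mem_choiceSet, Set.mem_univ, not_true, not_false_iff, iff_true]
      exact em _
  have h2 : (yIdx ⟨0, hd⟩) ∉ (nodeSet hd)ᶜ := by
    simp [yIdx_mem_nodeSet]
  have h3 := Set.ncard_insert_of_notMem h2 (Set.toFinite _)
  rw [h1] at h3
  exact h3.symm.trans (card_compl_choiceSet Set.univ)

/-- The prime ideal `(x_1, …, x_d, x_{d+1})` has height at most one. -/
lemma height_nodeSet_le (hd : 0 < d) : (varIdeal k (nodeSet hd)).height ≤ 1 := by
  refine Ideal.height_le_one_of_isPrincipal_of_mem_minimalPrimes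
    -- Krull's principal ideal theorem for x_1 + y_1: a prime containing it contains x_1 or y_1, as
    -- their product is zero, hence both. If it lies inside the given prime it omits the other y_i,
    -- so it contains the other x_i.
    (Ideal.span {xbar k (xIdx ⟨0, hd⟩) + xbar k (yIdx ⟨0, hd⟩)}) _
    ⟨⟨(isTransversal_nodeSet hd).isPrime, ?_⟩, ?_⟩
  · rw [Ideal.span_singleton_le_iff_mem]
    exact add_mem (xbar_mem_varIdeal.2 (xIdx_mem_nodeSet hd _))
      (xbar_mem_varIdeal.2 ((yIdx_mem_nodeSet hd).2 rfl))
  · rintro q ⟨hq, hle⟩ hqp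
    rw [Ideal.span_singleton_le_iff_mem] at hle
    have h0 : ∀ i, xbar k (xIdx i) * xbar k (yIdx i) ∈ q := fun i => by
      rw [xbar_mul]
      exact q.zero_mem
    have h1 : xbar k (xIdx ⟨0, hd⟩) ∈ q ∧ xbar k (yIdx ⟨0, hd⟩) ∈ q := by
      rcases hq.mem_or_mem (h0 ⟨0, hd⟩) with h | h
      · exact ⟨h, (Ideal.add_mem_iff_right q h).1 hle⟩
      · exact ⟨(Ideal.add_mem_iff_left q h).1 hle, h⟩
    rw [varIdeal, Ideal.span_le]
    rintro _ ⟨j, hj, rfl⟩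
    rcases xIdx_or_yIdx j with ⟨i, rfl⟩ | ⟨i, rfl⟩
    · by_cases hi : i = ⟨0, hd⟩
      · rw [hi]
        exact h1.1
      · refine (hq.mem_or_mem (h0 i)).resolve_right fun h => hi ?_
        exact (yIdx_mem_nodeSet hd).1 (xbar_mem_varIdeal.1 (hqp h))
    · rw [(yIdx_mem_nodeSet hd).1 hj]
      exact h1.2

/-- Modulo the prime (x_1, …, x_d) the equation becomes s y_1 = 0 with y_1 nonzero. So y_1 is not a
multiple of x_1 at the node. -/
lemma mem_nodeSet_of_mul_yIdx_eq (hd : 0 < d) {s a : ExRing k d}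
    (h : s * xbar k (yIdx ⟨0, hd⟩) = a * xbar k (xIdx ⟨0, hd⟩)) :
    s ∈ varIdeal k (nodeSet hd) := by
  have hp := (isTransversal_choiceSet (d := d) Set.univ).isPrime (k := k)
  have h1 : s * xbar k (yIdx ⟨0, hd⟩) ∈ varIdeal k (choiceSet (d := d) Set.univ) := by
    rw [h]
    exact Ideal.mul_mem_left _ _ (xbar_mem_varIdeal.2 (xIdx_mem_choiceSet.2 trivial))
  refine varIdeal_mono (Set.subset_insert _ _) ((hp.mem_or_mem h1).resolve_right fun h2 => ?_)
  exact yIdx_mem_choiceSet.1 (xbar_mem_varIdeal.1 h2) trivial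

/-- In the domain R/Q the squared ideal becomes (x²), and one factor x can be cancelled. -/
lemma mem_sup_of_mul_mem_sq {R : Type u} [CommRing R] {Q : Ideal R} (hQ : Q.IsPrime) {x s : R}
    (hx : x ∉ Q) (h : s * x ∈ (Ideal.span {x} ⊔ Q) ^ 2) : s ∈ Ideal.span {x} ⊔ Q := by
  have h1 : (Ideal.span {x} ⊔ Q) ^ 2 ≤ Ideal.span {x * x} ⊔ Q := by
    rw [pow_two, Ideal.sup_mul, Ideal.mul_sup, Ideal.span_singleton_mul_span_singleton]
    exact sup_le (sup_le le_sup_left (Ideal.mul_le_right.trans le_sup_right))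
      (Ideal.mul_le_left.trans le_sup_right)
  obtain ⟨y, hy, z, hz, hyz⟩ := Submodule.mem_sup.1 (h1 h)
  obtain ⟨t, rfl⟩ := Ideal.mem_span_singleton'.1 hy
  have h2 : (s - t * x) * x ∈ Q := by
    convert hz using 1
    linear_combination -hyz
  have h3 : s - t * x ∈ Q := (hQ.mem_or_mem h2).resolve_right hx
  have h4 : s = t * x + (s - t * x) := by ring
  rw [h4]
  exact Submodule.add_mem_sup (Ideal.mem_span_singleton'.2 ⟨t, rfl⟩) h3

lemma mem_nodeSet_of_mul_mem_sq (hd : 0 < d) {s : ExRing k d}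
    (h : s * xbar k (xIdx ⟨0, hd⟩) ∈ varIdeal k (nodeSet hd) ^ 2) :
    s ∈ varIdeal k (nodeSet hd) := by
  -- The node is also x_1 together with the minimal prime (y_1, x_2, …, x_d), which does not contain
  -- x_1.
  have hA : nodeSet hd = insert (xIdx ⟨0, hd⟩) (choiceSet {i | i ≠ ⟨0, hd⟩}) := by
    ext j
    rcases xIdx_or_yIdx j with ⟨i, rfl⟩ | ⟨i, rfl⟩
    · simp only [xIdx_mem_nodeSet, Set.mem_insert_iff, xIdx_injective.eq_iff, xIdx_mem_choiceSet,
        Set.mem_ofPred_eq, true_iff]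
      exact em _
    · simp only [yIdx_mem_nodeSet, Set.mem_insert_iff, (xIdx_ne_yIdx _ _).symm,
        yIdx_mem_choiceSet, Set.mem_ofPred_eq, false_or, not_not, ne_eq]
  rw [hA, varIdeal_insert] at h ⊢
  exact mem_sup_of_mul_mem_sq (isTransversal_choiceSet _).isPrime
    (fun h => xIdx_mem_choiceSet.1 (xbar_mem_varIdeal.1 h) rfl) h

/-- If the maximal ideal of `R_p` is principal, then for `x, y ∈ p` either `y` is a multiple of
`x` in `R_p`, or `x` lies in the square of the maximal ideal. -/
lemma exists_of_isPrincipal_maximalIdeal {R : Type u} [CommRing R] (p : Ideal R) [p.IsPrime]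
    (h : (IsLocalRing.maximalIdeal (Localization.AtPrime p)).IsPrincipal) {x y : R} (hx : x ∈ p)
    (hy : y ∈ p) : ∃ s ∉ p, (∃ a, s * y = a * x) ∨ s * x ∈ p ^ 2 := by
  let f := algebraMap R (Localization.AtPrime p)
  obtain ⟨t, ht⟩ := h.principal
  have hm : ∀ z ∈ p, ∃ u, u * t = f z := by
    intro z hz
    have : f z ∈ IsLocalRing.maximalIdeal (Localization.AtPrime p) :=
      (IsLocalization.AtPrime.to_map_mem_maximal_iff _ p z).2 hz
    rw [ht] at this
    exact Ideal.mem_span_singleton'.1 this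
  obtain ⟨u, hu⟩ := hm x hx
  obtain ⟨v, hv⟩ := hm y hy
  -- With t a generator and x = ut: if u is a unit then x itself generates the maximal ideal, and
  -- otherwise u is in the maximal ideal and x in its square.
  by_cases huu : IsUnit u
  · obtain ⟨u, rfl⟩ := huu
    obtain ⟨⟨a, s⟩, has⟩ := IsLocalization.surj p.primeCompl (v * (↑u⁻¹ : Localization.AtPrime p))
    have h1 : f (s * y) = f (a * x) := by
      rw [map_mul, map_mul, ← hu, ← hv, ← has]
      linear_combination (-(f s) * v * t) * u.inv_mul
    obtain ⟨c, hc⟩ := (IsLocalization.eq_iff_exists p.primeCompl _).1 h1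
    exact ⟨c * s, (c * s).2, Or.inl ⟨c * a, by rw [mul_assoc, mul_assoc]; exact hc⟩⟩
  · have h1 : f x ∈ (p ^ 2).map f := by
      rw [Ideal.map_pow, Localization.AtPrime.map_eq_maximalIdeal, ← hu, pow_two]
      exact Ideal.mul_mem_mul huu (ht ▸ Ideal.mem_span_singleton_self t)
    obtain ⟨s, hs, hsx⟩ := (IsLocalization.algebraMap_mem_map_algebraMap_iff p.primeCompl _ _ _).1 h1
    exact ⟨s, hs, Or.inr hsx⟩

theorem not_isRegularInCodim_one (hd : 0 < d) : ¬ IsRegularInCodim w (relIdeal k d) 1 := by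
  intro h
  have hp := (isTransversal_nodeSet hd).isPrime (k := k)
  have hreg := h (varIdeal k (nodeSet hd)) (isHomogeneousIdeal_varIdeal w _) (by
    rw [ringKrullDim_exRing, (isTransversal_nodeSet hd).ringKrullDim]
    exact_mod_cast (card_compl_nodeSet hd).ge)
  -- Regularity equates the number of generators of the maximal ideal with the height, at most one,
  -- so that ideal would be principal.
  have h1 := hreg.spanFinrank_maximalIdeal
  rw [IsLocalization.AtPrime.ringKrullDim_eq_height (varIdeal k (nodeSet hd))] at h1
  have h2 : (IsLocalRing.maximalIdeal
      (Localization.AtPrime (varIdeal k (nodeSet hd)))).spanFinrank ≤ 1 := by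
    have h3 := height_nodeSet_le (k := k) hd
    have h4 : (((IsLocalRing.maximalIdeal
      (Localization.AtPrime (varIdeal k (nodeSet hd)))).spanFinrank : ℕ∞) : WithBot ℕ∞) ≤ (1 : ℕ∞) :=
      h1.trans_le (WithBot.coe_le_coe.2 h3)
    exact_mod_cast h4
  have h3 : (IsLocalRing.maximalIdeal
      (Localization.AtPrime (varIdeal k (nodeSet hd)))).IsPrincipal := by
    have hfg : (IsLocalRing.maximalIdeal
      (Localization.AtPrime (varIdeal k (nodeSet hd)))).FG := IsNoetherian.noetherian _
    rcases Nat.le_one_iff_eq_zero_or_eq_one.1 h2 with h0 | h0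
    · rw [(Submodule.spanFinrank_eq_zero_iff_eq_bot hfg).1 h0]
      exact bot_isPrincipal
    · exact ((Submodule.spanFinrank_eq_one_iff _).1 h0).1
  obtain ⟨s, hs, ⟨a, ha⟩ | hsx⟩ := exists_of_isPrincipal_maximalIdeal _ h3
    (xbar_mem_varIdeal.2 (xIdx_mem_nodeSet hd ⟨0, hd⟩))
    (xbar_mem_varIdeal.2 ((yIdx_mem_nodeSet hd).2 rfl))
  · exact hs (mem_nodeSet_of_mul_yIdx_eq hd ha)
  · exact hs (mem_nodeSet_of_mul_mem_sq hd hsx)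

end Regularity

end

end ExtAsymptotics

open ExtAsymptotics in
theorem mainTheorem9 (k : Type u) [Field k] (d r : ℕ) (hr : 1 ≤ r) (hrd : r ≤ d)
    (w : Fin (2 * d) → ℕ) (hw : ∀ j, 0 < w j) :
    -- `R` is a graded complete intersection, `M` and `N` are graded modules,
    -- and the even and odd Hilbert polynomials exist
    (IsGradedCompleteIntersection w (relIdeal k d) d ∧
      IsHomogeneousIdeal w (relIdeal k d) (idealM k d r) ∧
      IsHomogeneousIdeal w (relIdeal k d) (idealN k d r) ∧
      fext (ExRing k d) (ModM k d r) (ModN k d r) < ⊤ ∧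
      (∃ P, IsEvenHilbertPolynomial (ExRing k d) (ModM k d r) (ModN k d r) P) ∧
      (∃ P, IsOddHilbertPolynomial (ExRing k d) (ModM k d r) (ModN k d r) P)) ∧
    -- dimensions
    (Module.supportDim (ExRing k d) (ModM k d r) = (d : ℕ∞) ∧
      ringKrullDim (ExRing k d) = (d : ℕ∞) ∧
      Module.supportDim (ExRing k d) (ModN k d r) = (r : ℕ∞)) ∧
    -- complexity
    cx (ExRing k d) (ModM k d r) (ModN k d r) = r ∧
    -- the leading coefficients differ
    hInvariant (ExRing k d) (ModM k d r) (ModN k d r) ≠ 0 ∧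
    -- regularity
    (IsRegularInCodim w (relIdeal k d) 0 ∧
      (¬ ∃! p : Ideal (ExRing k d), p ∈ minimalPrimes (ExRing k d)) ∧
      ¬ IsRegularInCodim w (relIdeal k d) 1) ∧
    -- the additional hypotheses which would force `h = 0` when `cx = min (dim M) (dim N)` fail:
    -- regularity in codimension `d - r` if `r < d`, existence of a rank if `r = d`
    ((r < d → ¬ IsRegularInCodim w (relIdeal k d) (d - r)) ∧
      (r = d → ¬ HasARank (ExRing k d) (ModM k d r) ∧ ¬ HasARank (ExRing k d) (ModN k d r))) := by
  obtain ⟨q, rfl⟩ : ∃ q, r = q + 1 := ⟨r - 1, by omega⟩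
  have hd : 0 < d := by omega
  refine ⟨⟨isGradedCompleteIntersection_relIdeal w hw, isHomogeneousIdeal_varIdeal w _,
    isHomogeneousIdeal_varIdeal w _, fext_modM_modN hrd, ?_, ?_⟩,
    ⟨supportDim_modM hrd, ringKrullDim_exRing, supportDim_modN hrd⟩, cx_modM_modN hrd,
    hInvariant_modM_modN hrd, ⟨isRegularInCodim_zero w, not_existsUnique_minimalPrimes hd,
    not_isRegularInCodim_one w hd⟩, fun hlt h => ?_, fun heq => ?_⟩
  · rcases Nat.even_or_odd (q + 1) with h | h
    · exact ⟨_, (isHilbertPolynomial_of_even hrd h).1⟩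
    · exact ⟨_, (isHilbertPolynomial_of_odd hrd h).1⟩
  · rcases Nat.even_or_odd (q + 1) with h | h
    · exact ⟨_, (isHilbertPolynomial_of_even hrd h).2⟩
    · exact ⟨_, (isHilbertPolynomial_of_odd hrd h).2⟩
  -- Since d - r ≥ 1, regularity in codimension d - r would imply it in codimension one.
  · refine not_isRegularInCodim_one w hd fun p hp hh hdim => h p hh (hdim.trans ?_)
    gcongr
    exact_mod_cast (by omega : 1 ≤ d - (q + 1))
  · rw [heq]
    exact ⟨not_hasARank_modM hd, not_hasARank_modN hd⟩
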